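/- Let $(\Omega,\mathcal F,\mathbb P)$ be a complete probability space and let $\gamma=(\gamma_t)_{t\ge 0}$ be a standard gamma process on it: $\gamma_0=0$ almost surely, $\gamma$ has independent increments, $\gamma_t-\gamma_s$ has the gamma distribution with shape $t-s$ and rate $1$ for all $0\le s<t$, and the paths of $\gamma$ are almost surely càdlàg and nondecreasing. Let $\tau:\Omega\to(0,\infty)$ be a random variable that is independent of the process $\gamma$ and satisfies $\mathbb E[\tau^\alpha]<\infty$ for some $\alpha>0$. Let $$\zeta_t=\frac{\gamma_{t\wedge\tau}}{\gamma_\tau},\qquad t\ge 0,$$ be the gamma bridge with random length $\tau$. Put $\mathcal F^{\zeta}_t=\sigma(\zeta_s,\ s\le t)$, let $\mathcal N_{\mathbb P}$ be the collection of $\mathbb P$-null sets, and let $\mathcal F^{\zeta,c}_{t+}=\bigcap_{s>t}\big(\mathcal F^{\zeta}_s\vee\mathcal N_{\mathbb P}\big)$ and $\mathcal F^\zeta_{0+}=\bigcap_{s>0}\mathcal F^\zeta_s$. Then $\zeta$ is a Markov process with respect to $\mathbb F^{\zeta,c}_+=(\mathcal F^{\zeta,c}_{t+})_{t\ge 0}$: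 it is adapted to this filtration and, for all $t,h\ge 0$ and every bounded Borel function $f:\mathbb R\to\mathbb R$, $$\mathbb E\big[f(\zeta_{t+h})\,\big|\,\mathcal F^{\zeta,c}_{t+}\big]=\mathbb E\big[f(\zeta_{t+h})\,\big|\,\zeta_t\big]\qquad \mathbb P\text{-a.s.}$$ Moreover, $\mathcal F^{\zeta}_{0+}$ is $\mathbb P$-trivial: $\mathbb P(A)\in\{0,1\}$ for every $A\in\mathcal F^{\zeta}_{0+}$. -/

import Mathlib

open MeasureTheory ProbabilityTheory Filter Topology
open scoped NNReal ENNReal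

/-- A path on `[0, ∞)` that is right continuous with left limits. -/
def IsCadlagPath (x : ℝ≥0 → ℝ) : Prop :=
  ∀ t, ContinuousWithinAt x (Set.Ici t) t ∧ ∃ l, Tendsto x (𝓝[<] t) (𝓝 l)

/-- A standard gamma process: a process `γ` started at `0`, with independent increments, such that
`γ t - γ s` has the gamma distribution with shape `t - s` and rate `1` for all `s < t`, and whose
paths are almost surely càdlàg and nondecreasing. -/
structure IsStandardGammaProcess {Ω : Type*} {mΩ : MeasurableSpace Ω} (γ : ℝ≥0 → Ω → ℝ)
    (P : Measure Ω) : Prop where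
  measurable : ∀ t, Measurable (γ t)
  zero : ∀ᵐ ω ∂P, γ 0 ω = 0
  indep_increments : HasIndepIncrements γ P
  law_increments : ∀ s t, s < t →
    HasLaw (fun ω ↦ γ t ω - γ s ω) (gammaMeasure ((t : ℝ) - (s : ℝ)) 1) P
  cadlag : ∀ᵐ ω ∂P, IsCadlagPath (fun t ↦ γ t ω)
  monotone : ∀ᵐ ω ∂P, Monotone (fun t ↦ γ t ω)

/-- The gamma bridge of random length `τ`, `ζ_t = γ_{t ∧ τ} / γ_τ`. -/
noncomputable def gammaBridge {Ω : Type*} (γ : ℝ≥0 → Ω → ℝ) (τ : Ω → ℝ≥0) (t : ℝ≥0) (ω : Ω) : ℝ :=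
  γ (min t (τ ω)) ω / γ (τ ω) ω

/-- The completion of a filtration on a complete measure space: every `σ`-algebra is enlarged by
all the null sets. -/
def completedFiltration {Ω : Type*} {mΩ : MeasurableSpace Ω} (P : Measure Ω) [P.IsComplete]
    (𝓕 : Filtration ℝ≥0 mΩ) : Filtration ℝ≥0 mΩ where
  seq t := 𝓕 t ⊔ MeasurableSpace.generateFrom {N | P N = 0}
  mono' _ _ hst := sup_le_sup_right (𝓕.mono hst) _
  le' t := sup_le (𝓕.le t)
    (MeasurableSpace.generateFrom_le fun N hN ↦ Measure.IsComplete.out' N hN)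

/-- The usual augmentation of a filtration: the right-continuous version `t ↦ ⋂ s > t` of its
completion. -/
noncomputable def usualAugmentation {Ω : Type*} {mΩ : MeasurableSpace Ω} (P : Measure Ω)
    [P.IsComplete] (𝓕 : Filtration ℝ≥0 mΩ) : Filtration ℝ≥0 mΩ :=
  (completedFiltration P 𝓕).rightCont

/-- `Y` is a (possibly inhomogeneous) Markov process with respect to the filtration `𝓕`: it is
adapted and `E[f(Y_{t+h}) | 𝓕_t] = E[f(Y_{t+h}) | Y_t]` almost surely, for all `t, h ≥ 0` and all
bounded Borel functions `f`. -/
def IsMarkovProcess {Ω : Type*} {mΩ : MeasurableSpace Ω} (P : Measure Ω)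
    (𝓕 : Filtration ℝ≥0 mΩ) (Y : ℝ≥0 → Ω → ℝ) : Prop :=
  (∀ t, Measurable[𝓕 t] (Y t)) ∧
  ∀ (t h : ℝ≥0) (f : ℝ → ℝ), Measurable f → (∃ C, ∀ x, |f x| ≤ C) →
    P[fun ω ↦ f (Y (t + h) ω) | 𝓕 t] =ᵐ[P]
      P[fun ω ↦ f (Y (t + h) ω) | MeasurableSpace.comap (Y t) inferInstance]

/-!
The proof compares the bridge `ζ` with the gamma process `γ` itself on the germ `σ`-algebra
`⋂ s > t, σ(x_r, r ≤ s)` of path space.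

Fix `u > t`. On `{u < τ}` the bridge up to time `u` is `ζ_u` times the normalized path
`b = γ_{· ∧ u} / γ_u`, and `γ` up to time `u` is `γ_u` times the same path. By Lukacs' independence
property (`indepFun_sum_of_isTiltDilation`, `IsStandardGammaProcess.indepFun_bridge`), `b` is
independent of `γ_u`, hence, the increments being independent, of `γ_u`, the increments of `γ` after
`u`, and `τ` together; these determine `ζ_r` for every `r ≥ u`. Moreover
`ζ_u = γ_u / (γ_u + g)` with `g = γ_τ - γ_u` independent of `γ_u`, so the law of `ζ_u` is absolutely
continuous with respect to that of `γ_u`. Therefore the law of `ζ` up to time `u` on `{u < τ}`, even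
when weighted by a function of `ζ_s` with `s ≥ u`, has a density with respect to the law of `γ`,
and this density is a function of the value of the path at `u` only
(`IsStandardGammaProcess.exists_density_gammaBridge`).

Now `γ` is a right-continuous process with independent increments, so its increments after `t` are
independent of the germ events at `t` (`indep_germSigma_futurePath`). Integrating out `γ_u - γ_t`
turns the density into a function of the value of the path at `t`, and summing over pieces of
`{t < τ}` on which `τ` exceeds some `u > t` gives the same statement on the whole of `{t < τ}`
(`IsStandardGammaProcess.exists_lintegral_gammaBridge`). The ratio of the weighted density to the
unweighted one is then a version of the conditional expectation of `f (ζ_s)` which depends on `ζ_t`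
only. On `{τ ≤ t}`, which is almost surely `{ζ_t = 1}`, there is nothing to prove, as `ζ` stays
at `1`.

For `t = 0` the density is constant, because `γ_0 = 0`: a germ event has the same probability
for `ζ` as for `γ`, and for `γ` this is `0` or `1` by Blumenthal's zero-one law.
-/

section GammaBridge

/-! ### Exponential tilting of gamma laws -/

/-- Two finite laws whose moment generating functions are finite and equal near `0` coincide. -/
theorem map_eq_of_mgf_eventuallyEq {Ω Ω' : Type*} {mΩ : MeasurableSpace Ω}
    {mΩ' : MeasurableSpace Ω'} {μ : Measure Ω} {μ' : Measure Ω'} [IsFiniteMeasure μ]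
    [IsFiniteMeasure μ'] {X : Ω → ℝ} {Y : Ω' → ℝ} (hX : AEMeasurable X μ)
    (hY : AEMeasurable Y μ') (hX0 : 0 ∈ interior (integrableExpSet X μ))
    (hY0 : 0 ∈ interior (integrableExpSet Y μ')) (h : mgf X μ =ᶠ[𝓝 0] mgf Y μ') :
    μ.map X = μ'.map Y := by
  set U : Set ℂ := {z | z.re ∈ interior (integrableExpSet X μ) ∩ interior (integrableExpSet Y μ')}
    with hU
  have hUc : IsPreconnected U :=
    ((convex_integrableExpSet.interior.inter convex_integrableExpSet.interior).linear_preimage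
      Complex.reLm).isPreconnected
  have hXa : AnalyticOnNhd ℂ (complexMGF X μ) U := fun z hz ↦ analyticAt_complexMGF hz.1
  have hYa : AnalyticOnNhd ℂ (complexMGF Y μ') U := fun z hz ↦ analyticAt_complexMGF hz.2
  have h_real : ∃ᶠ x : ℝ in 𝓝[≠] 0, complexMGF X μ x = complexMGF Y μ' x := by
    refine Eventually.frequently ?_
    filter_upwards [h.filter_mono nhdsWithin_le_nhds] with x hx
    rw [complexMGF_ofReal, complexMGF_ofReal, hx]
  have h_freq : ∃ᶠ z : ℂ in 𝓝[≠] 0, complexMGF X μ z = complexMGF Y μ' z := by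
    have : Tendsto (fun x : ℝ ↦ (x : ℂ)) (𝓝[≠] 0) (𝓝[≠] 0) := by
      refine tendsto_nhdsWithin_iff.2 ⟨?_, ?_⟩
      · exact (Complex.continuous_ofReal.tendsto' 0 0 (by simp)).mono_left nhdsWithin_le_nhds
      · filter_upwards [self_mem_nhdsWithin] with x hx
        simpa using hx
    exact this.frequently h_real
  have h0 : (0 : ℂ) ∈ U := by simp [hU, hX0, hY0]
  have hEq := hXa.eqOn_of_preconnected_of_frequently_eq hYa hUc h0 h_freq
  refine Measure.ext_of_charFun (funext fun t ↦ ?_)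
  rw [← complexMGF_mul_I hX, ← complexMGF_mul_I hY]
  exact hEq (by simp [hU, hX0, hY0])

/-- A law on `ℝ` whose exponential tilt by `x ↦ exp (t * x)` is, for every `t < 1` and up to a
finite constant, its image under the dilation of ratio `(1 - t)⁻¹`. The gamma laws of rate `1` and
the Dirac mass at `0` have this property. -/
def IsTiltDilation (μ : Measure ℝ) : Prop :=
  ∀ t < 1, ∃ c : ℝ≥0∞, c ≠ ∞ ∧
    μ.withDensity (fun x ↦ ENNReal.ofReal (Real.exp (t * x))) = c • μ.map (fun x ↦ (1 - t)⁻¹ * x)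

theorem isTiltDilation_dirac_zero : IsTiltDilation (Measure.dirac 0) := by
  refine fun t _ ↦ ⟨1, by simp, ?_⟩
  rw [Measure.map_dirac' (by fun_prop), mul_zero, one_smul]
  ext s hs
  rw [withDensity_apply _ hs, ← lintegral_indicator hs, lintegral_dirac' _
    ((by fun_prop : Measurable _).indicator hs), Measure.dirac_apply' _ hs]
  by_cases h : (0 : ℝ) ∈ s <;> simp [h]

theorem isTiltDilation_gammaMeasure {a : ℝ} (ha : 0 < a) : IsTiltDilation (gammaMeasure a 1) := by
  intro t ht
  have hr : 0 < 1 - t := by linarith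
  have hmp : Measurable (gammaPDF a 1) := (measurable_gammaPDFReal a 1).ennreal_ofReal
  have hexp : Measurable fun x : ℝ ↦ ENNReal.ofReal (Real.exp (t * x)) := by fun_prop
  refine ⟨ENNReal.ofReal ((1 - t)⁻¹ ^ a), ENNReal.ofReal_ne_top, ?_⟩
  ext s hs
  have hdil : Measurable fun x : ℝ ↦ (1 - t)⁻¹ * x := by fun_prop
  have hvol : ∀ F : ℝ → ℝ≥0∞, Measurable F → ∫⁻ x in s, F x =
      ∫⁻ x in (fun x ↦ (1 - t)⁻¹ * x) ⁻¹' s,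
        ENNReal.ofReal |(1 - t)⁻¹| * F ((1 - t)⁻¹ * x) := fun F hF ↦ by
    have hFd : Measurable fun x ↦ F ((1 - t)⁻¹ * x) := hF.comp hdil
    rw [lintegral_const_mul _ hFd, ← setLIntegral_map hs hF hdil, ← smul_eq_mul,
      ← lintegral_smul_measure, ← Measure.restrict_smul,
      Real.smul_map_volume_mul_left (inv_ne_zero hr.ne')]
  rw [gammaMeasure, ← withDensity_mul _ hmp hexp, withDensity_apply _ hs, Measure.smul_apply,
    Measure.map_apply hdil hs, withDensity_apply _ (hdil hs), hvol _ (hmp.mul hexp), smul_eq_mul,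
    ← lintegral_const_mul _ hmp]
  refine lintegral_congr fun x ↦ ?_
  simp only [Pi.mul_apply, gammaPDF]
  rcases lt_or_ge x 0 with hx | hx
  · have : (1 - t)⁻¹ * x < 0 := mul_neg_of_pos_of_neg (inv_pos.2 hr) hx
    simp [gammaPDFReal, hx.not_ge, this.not_ge]
  · have h' : 0 ≤ (1 - t)⁻¹ * x := by positivity
    rw [abs_of_pos (inv_pos.2 hr), ← ENNReal.ofReal_mul' (Real.exp_pos _).le,
      ← ENNReal.ofReal_mul (by positivity), ← ENNReal.ofReal_mul (by positivity)]
    congr 1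
    simp only [gammaPDFReal, hx, h', if_true, Real.one_rpow, one_mul]
    rw [Real.mul_rpow (by positivity) hx, Real.rpow_sub_one (inv_ne_zero hr.ne')]
    have : Real.exp (-((1 - t)⁻¹ * x)) * Real.exp (t * ((1 - t)⁻¹ * x)) = Real.exp (-x) := by
      rw [← Real.exp_add]
      congr 1
      field_simp
      ring
    rw [← this]
    field_simp

/-- A law with the tilt-dilation property tensorizes: tilting a finite product of such laws by the
exponential of the sum of the coordinates amounts to a dilation. -/
theorem pi_withDensity_exp_sum {n : ℕ} {μ : Fin n → Measure ℝ} [∀ i, IsProbabilityMeasure (μ i)]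
    (hμ : ∀ i, IsTiltDilation (μ i)) {t : ℝ} (ht : t < 1) :
    ∃ c : ℝ≥0∞, c ≠ ∞ ∧
      (Measure.pi μ).withDensity (fun x ↦ ENNReal.ofReal (Real.exp (t * ∑ i, x i))) =
        c • (Measure.pi μ).map (fun x ↦ (1 - t)⁻¹ • x) := by
  choose c hc hμc using fun i ↦ hμ i t ht
  refine ⟨∏ i, c i, (ENNReal.prod_lt_top fun i _ ↦ (hc i).lt_top).ne, ?_⟩
  have hfin : ∀ i, IsFiniteMeasure ((μ i).withDensity
      (fun x ↦ ENNReal.ofReal (Real.exp (t * x)))) := fun i ↦ by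
    rw [hμc i]
    exact ⟨by simpa using ENNReal.mul_lt_top (hc i).lt_top (measure_lt_top _ _)⟩
  have hpi : Measure.pi (fun i ↦ (μ i).withDensity
        (fun x ↦ ENNReal.ofReal (Real.exp (t * x)))) =
      (∏ i, c i) • (Measure.pi μ).map (fun x ↦ (1 - t)⁻¹ • x) := by
    refine Measure.pi_eq fun s hs ↦ ?_
    have hmap : (Measure.pi μ).map (fun x ↦ (1 - t)⁻¹ • x) =
        Measure.pi (fun i ↦ (μ i).map (fun x ↦ (1 - t)⁻¹ * x)) := by
      have : ∀ i, IsProbabilityMeasure ((μ i).map (fun x ↦ (1 - t)⁻¹ * x)) := fun i ↦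
        Measure.isProbabilityMeasure_map (by fun_prop)
      rw [← Measure.pi_map_pi (fun i ↦ (by fun_prop))]
      rfl
    have : ∀ i, IsProbabilityMeasure ((μ i).map (fun x ↦ (1 - t)⁻¹ * x)) := fun i ↦
        Measure.isProbabilityMeasure_map (by fun_prop)
    rw [hmap, Measure.smul_apply, Measure.pi_pi, smul_eq_mul, ← Finset.prod_mul_distrib]
    exact Finset.prod_congr rfl fun i _ ↦ by rw [hμc i]; rfl
  rw [← hpi]
  refine (Measure.pi_eq fun s hs ↦ ?_).symm
  rw [withDensity_apply _ (MeasurableSet.univ_pi hs), ← lintegral_indicator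
    (MeasurableSet.univ_pi hs)]
  have hind := iIndepFun_pi (μ := μ) (X := fun i x ↦ (s i).indicator
    (fun x ↦ ENNReal.ofReal (Real.exp (t * x))) x)
    (fun i ↦ ((by fun_prop : Measurable _).indicator (hs i)).aemeasurable)
  have hmeas : ∀ i, Measurable ((s i).indicator
    (fun x : ℝ ↦ ENNReal.ofReal (Real.exp (t * x)))) := fun i ↦
      (by fun_prop : Measurable _).indicator (hs i)
  have := lintegral_prod_eq_prod_lintegral_of_indepFun Finset.univ _ hind
    (fun i ↦ (hmeas i).comp (measurable_pi_apply i))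
  calc _ = ∫⁻ x, ∏ i, (s i).indicator (fun x ↦ ENNReal.ofReal (Real.exp (t * x))) (x i)
        ∂Measure.pi μ := by
        refine lintegral_congr fun x ↦ ?_
        by_cases hx : x ∈ Set.univ.pi s
        · rw [Set.indicator_of_mem hx, Finset.mul_sum, Real.exp_sum,
            ENNReal.ofReal_prod_of_nonneg (fun _ _ ↦ (Real.exp_pos _).le)]
          exact Finset.prod_congr rfl fun i _ ↦
            (Set.indicator_of_mem (hx i (Set.mem_univ i))
              (fun x ↦ ENNReal.ofReal (Real.exp (t * x)))).symm
        · rw [Set.indicator_of_notMem hx]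
          obtain ⟨i, hi⟩ : ∃ i, x i ∉ s i := by simpa [Set.mem_pi] using hx
          exact (Finset.prod_eq_zero (Finset.mem_univ i) (Set.indicator_of_notMem hi _)).symm
    _ = _ := by
        rw [this]
        refine Finset.prod_congr rfl fun i _ ↦ ?_
        rw [withDensity_apply _ (hs i), ← lintegral_indicator (hs i)]
        exact (measurePreserving_eval μ i).lintegral_comp (hmeas i)

/-- **Lukacs' independence property.** Among independent gamma variables of rate `1`, any function
of the ratios (any function invariant under dilation) is independent of the sum: tilting by
`exp (t * ∑ D i)` only dilates the vector `D`, so conditioning on such a function does not change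
the moment generating function of the sum. -/
theorem indepFun_sum_of_isTiltDilation {Ω β : Type*} {mΩ : MeasurableSpace Ω}
    [MeasurableSpace β] {P : Measure Ω} [IsProbabilityMeasure P] {n : ℕ} {D : Fin n → Ω → ℝ}
    (hDm : ∀ i, Measurable (D i)) (hD : iIndepFun D P) (hDt : ∀ i, IsTiltDilation (P.map (D i)))
    {g : (Fin n → ℝ) → β} (hg : Measurable g) (hg_inv : ∀ r : ℝ, 0 < r → ∀ x, g (r • x) = g x) :
    IndepFun (fun ω ↦ g (fun i ↦ D i ω)) (fun ω ↦ ∑ i, D i ω) P := by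
  have hDv : Measurable (fun ω i ↦ D i ω) := measurable_pi_lambda _ hDm
  have hprob : ∀ i, IsProbabilityMeasure (P.map (D i)) := fun i ↦
    Measure.isProbabilityMeasure_map (hDm i).aemeasurable
  have hlaw := (iIndepFun_iff_map_fun_eq_pi_map (fun i ↦ (hDm i).aemeasurable)).1 hD
  have hS : Measurable (fun ω ↦ ∑ i, D i ω) := by fun_prop
  have key : ∀ t < 1, ∃ c : ℝ≥0∞, c ≠ ∞ ∧ ∀ B : Set β, MeasurableSet B →
      ∫⁻ ω in (fun ω ↦ g (fun i ↦ D i ω)) ⁻¹' B,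
        ENNReal.ofReal (Real.exp (t * ∑ i, D i ω)) ∂P =
        c * P ((fun ω ↦ g (fun i ↦ D i ω)) ⁻¹' B) := by
    intro t ht
    obtain ⟨c, hc, h⟩ := pi_withDensity_exp_sum hDt ht
    rw [← hlaw] at h
    refine ⟨c, hc, fun B hB ↦ ?_⟩
    have h1 := congrArg (fun ν ↦ ν (g ⁻¹' B)) h
    have hinv : (fun x : Fin n → ℝ ↦ (1 - t)⁻¹ • x) ⁻¹' (g ⁻¹' B) = g ⁻¹' B := by
      ext x
      simp [hg_inv (1 - t)⁻¹ (by simpa using ht)]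
    rw [withDensity_apply _ (hg hB), setLIntegral_map (hg hB) (by fun_prop) hDv,
      Measure.smul_apply, Measure.map_apply (by fun_prop) (hg hB), hinv,
      Measure.map_apply hDv (hg hB), smul_eq_mul] at h1
    exact h1
  have hint : ∀ t < 1, Integrable (fun ω ↦ Real.exp (t * ∑ i, D i ω)) P := by
    intro t ht
    obtain ⟨c, hc, h⟩ := key t ht
    refine ⟨by fun_prop, ?_⟩
    rw [hasFiniteIntegral_iff_ofReal (Eventually.of_forall fun _ ↦ (Real.exp_pos _).le)]
    have := h Set.univ MeasurableSet.univ
    rw [Set.preimage_univ, setLIntegral_univ] at this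
    rw [this]
    simpa using hc.lt_top
  have h0 : ∀ μ : Measure Ω, (∀ t < 1, Integrable (fun ω ↦ Real.exp (t * ∑ i, D i ω)) μ) →
      0 ∈ interior (integrableExpSet (fun ω ↦ ∑ i, D i ω) μ) := fun μ hμ ↦
    mem_interior.2 ⟨Set.Iio 1, fun t ht ↦ hμ t ht, isOpen_Iio, by simp⟩
  rw [indepFun_iff_measure_inter_preimage_eq_mul]
  intro B T hB hT
  set A := (fun ω ↦ g (fun i ↦ D i ω)) ⁻¹' B with hA
  have hfinA : IsFiniteMeasure (P A • P) := ⟨by simp⟩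
  have hmap : (P.restrict A).map (fun ω ↦ ∑ i, D i ω) = (P A • P).map (fun ω ↦ ∑ i, D i ω) := by
    refine map_eq_of_mgf_eventuallyEq hS.aemeasurable hS.aemeasurable
      (h0 _ fun t ht ↦ (hint t ht).restrict)
      (h0 _ fun t ht ↦ (hint t ht).smul_measure (measure_ne_top _ _)) ?_
    filter_upwards [Iio_mem_nhds (zero_lt_one' ℝ)] with t ht
    obtain ⟨c, hc, h⟩ := key t ht
    have hU := h Set.univ MeasurableSet.univ
    rw [Set.preimage_univ, setLIntegral_univ, measure_univ, mul_one] at hU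
    rw [mgf, mgf, integral_smul_measure,
      integral_eq_lintegral_of_nonneg_ae (Eventually.of_forall fun _ ↦ (Real.exp_pos _).le)
        (by fun_prop),
      integral_eq_lintegral_of_nonneg_ae (Eventually.of_forall fun _ ↦ (Real.exp_pos _).le)
        (by fun_prop), h B hB, hU, ENNReal.toReal_mul, smul_eq_mul, mul_comm]
  have := congrArg (fun ν ↦ ν T) hmap
  simp only [Measure.map_apply hS hT, Measure.restrict_apply (hS hT), Measure.smul_apply,
    smul_eq_mul] at this
  rw [Set.inter_comm, this]

/-! ### Past and future of a process with independent increments -/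

/-- The path `x` stopped at time `u`. -/
def stopPath (u : ℝ≥0) (x : ℝ≥0 → ℝ) : ℝ≥0 → ℝ := fun s ↦ x (min s u)

/-- The increments of the path `x` after time `u`. -/
def futurePath (u : ℝ≥0) (x : ℝ≥0 → ℝ) : ℝ≥0 → ℝ := fun r ↦ x (u + r) - x u

/-- The `σ`-algebra of path events that depend only on the path up to time `u`. -/
@[reducible] def pastSigma (u : ℝ≥0) : MeasurableSpace (ℝ≥0 → ℝ) :=
  MeasurableSpace.comap (stopPath u) MeasurableSpace.pi

/-- The `σ`-algebra of path events that depend only on the path up to time `s`, for every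
`s > t`. -/
@[reducible] def germSigma (t : ℝ≥0) : MeasurableSpace (ℝ≥0 → ℝ) := ⨅ s > t, pastSigma s

theorem measurable_stopPath (u : ℝ≥0) : Measurable (stopPath u) :=
  measurable_pi_lambda _ fun _ ↦ measurable_pi_apply _

theorem measurable_futurePath (u : ℝ≥0) : Measurable (futurePath u) :=
  measurable_pi_lambda _ fun _ ↦ (measurable_pi_apply _).sub (measurable_pi_apply _)

theorem pastSigma_le_pi (u : ℝ≥0) : pastSigma u ≤ MeasurableSpace.pi :=
  (measurable_stopPath u).comap_le

theorem germSigma_le_pastSigma {t s : ℝ≥0} (h : t < s) : germSigma t ≤ pastSigma s :=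
  iInf₂_le s h

theorem germSigma_le_pi (t : ℝ≥0) : germSigma t ≤ MeasurableSpace.pi :=
  (germSigma_le_pastSigma (lt_add_one t)).trans (pastSigma_le_pi _)

theorem measurable_eval_pastSigma {s u : ℝ≥0} (h : s ≤ u) :
    Measurable[pastSigma u] (fun x : ℝ≥0 → ℝ ↦ x s) := by
  have : (fun x : ℝ≥0 → ℝ ↦ x s) = (fun x ↦ x s) ∘ stopPath u := by
    ext x
    simp [stopPath, h]
  rw [this]
  exact (measurable_pi_apply s).comp (comap_measurable _)

theorem pastSigma_mono : Monotone pastSigma := by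
  intro s u h
  rw [pastSigma, ← measurable_iff_comap_le]
  exact @measurable_pi_lambda _ _ _ (pastSigma u) _ _ fun r ↦
    measurable_eval_pastSigma ((min_le_right r s).trans h)

theorem measurable_eval_germSigma (t : ℝ≥0) :
    Measurable[germSigma t] (fun x : ℝ≥0 → ℝ ↦ x t) := by
  rw [measurable_iff_comap_le, germSigma]
  exact le_iInf₂ fun s hs ↦ measurable_iff_comap_le.1 (measurable_eval_pastSigma hs.le)

/-- A monotone sequence of times that starts at `0` and passes through `u` and through all the
times of a given finite set. -/
theorem exists_monotone_grid (I : Finset ℝ≥0) (u : ℝ≥0) :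
    ∃ (σ : ℕ → ℝ≥0) (m : ℕ), Monotone σ ∧ σ 0 = 0 ∧ σ m = u ∧
      (∀ s ∈ I, s ≤ u → ∃ k ≤ m, σ k = s) ∧ (∀ s ∈ I, u ≤ s → ∃ k, m ≤ k ∧ σ k = s) := by
  classical
  set J := insert 0 (insert u I) with hJ
  have hJ0 : 0 < J.card := Finset.card_pos.2 ⟨0, by simp [hJ]⟩
  let σ : ℕ → ℝ≥0 := fun k ↦ J.orderEmbOfFin rfl ⟨min k (J.card - 1), by omega⟩
  have hmono : Monotone σ := fun a b hab ↦
    (J.orderEmbOfFin rfl).monotone (Fin.mk_le_mk.2 (min_le_min_right _ hab))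
  have hsurj : ∀ s ∈ J, ∃ k, σ k = s := by
    intro s hs
    have : s ∈ Set.range (J.orderEmbOfFin rfl) := by
      rw [Finset.range_orderEmbOfFin]
      exact hs
    obtain ⟨k, hk⟩ := this
    refine ⟨k, ?_⟩
    rw [← hk]
    have hk' : (k : ℕ) ≤ J.card - 1 := by have := k.2; omega
    exact congrArg (J.orderEmbOfFin rfl) (Fin.ext (min_eq_left hk'))
  obtain ⟨m, hm⟩ := hsurj u (by simp [hJ])
  obtain ⟨k0, hk0⟩ := hsurj 0 (by simp [hJ])
  refine ⟨σ, m, hmono, ?_, hm, fun s hs hsu ↦ ?_, fun s hs hsu ↦ ?_⟩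
  · exact le_antisymm (hk0 ▸ hmono (Nat.zero_le k0)) zero_le
  · obtain ⟨k, hk⟩ := hsurj s (by simp [hJ, hs])
    rcases le_total k m with h | h
    · exact ⟨k, h, hk⟩
    · exact ⟨m, le_rfl, le_antisymm (hk ▸ hmono h) (hm ▸ hsu)⟩
  · obtain ⟨k, hk⟩ := hsurj s (by simp [hJ, hs])
    rcases le_total m k with h | h
    · exact ⟨k, h, hk⟩
    · exact ⟨m, le_rfl, le_antisymm (hm ▸ hsu) (hk ▸ hmono h)⟩

variable {Ω : Type*} {mΩ : MeasurableSpace Ω} {P : Measure Ω} {γ : ℝ≥0 → Ω → ℝ}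

section IndependentIncrements

variable [IsProbabilityMeasure P]

/-- For a process with independent increments started at `0`, the path up to time `u` is
independent of the increments after `u`. -/
theorem indepFun_stopPath_futurePath (hm : ∀ t, Measurable (γ t)) (h0 : ∀ᵐ ω ∂P, γ 0 ω = 0)
    (hγ : HasIndepIncrements γ P) (u : ℝ≥0) :
    IndepFun (fun ω ↦ stopPath u (fun t ↦ γ t ω)) (fun ω ↦ futurePath u (fun t ↦ γ t ω)) P := by
  classical
  suffices h : IndepFun (fun ω (s : ℝ≥0) ↦ γ (min s u) ω - γ 0 ω)
      (fun ω (r : ℝ≥0) ↦ γ (u + r) ω - γ u ω) P by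
    refine h.process_congr_left (X' := fun s ω ↦ γ (min s u) ω) fun s ↦ ?_
    filter_upwards [h0] with ω hω
    simp [hω]
  refine IndepFun.process_indepFun_process (X := fun s ω ↦ γ (min s u) ω - γ 0 ω)
    (Y := fun r ω ↦ γ (u + r) ω - γ u ω) (fun s ↦ (hm _).sub (hm _))
    (fun r ↦ (hm _).sub (hm _)) fun I J ↦ ?_
  obtain ⟨σ, m, hσ, hσ0, hσm, hpast, hfut⟩ :=
    exists_monotone_grid (I.image (fun s ↦ min s u) ∪ J.image (fun r ↦ u + r)) u
  set D : ℕ → Ω → ℝ := fun k ω ↦ γ (σ (k + 1)) ω - γ (σ k) ω with hD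
  have hDm : ∀ k, Measurable (D k) := fun k ↦ (hm _).sub (hm _)
  have hind : Indep (⨆ k ∈ {k | k < m}, MeasurableSpace.comap (D k) inferInstance)
      (⨆ k ∈ {k | m ≤ k}, MeasurableSpace.comap (D k) inferInstance) P :=
    indep_iSup_of_disjoint (fun k ↦ (hDm k).comap_le) (hγ.nat hσ)
      (Set.disjoint_left.2 fun k hk hk' ↦ absurd hk (not_lt.2 (show m ≤ k from hk')))
  have hDmeas : ∀ (S : Set ℕ) (k : ℕ), k ∈ S →
      Measurable[⨆ k ∈ S, MeasurableSpace.comap (D k) inferInstance] (D k) := fun S k hk ↦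
    measurable_iff_comap_le.2
      (le_iSup₂ (f := fun k (_ : k ∈ S) ↦ MeasurableSpace.comap (D k) inferInstance) k hk)
  rw [IndepFun_iff_Indep]
  refine indep_of_indep_of_le_left (indep_of_indep_of_le_right hind ?_) ?_
  · rw [← measurable_iff_comap_le]
    refine @measurable_pi_lambda _ _ _ (_) _ _ fun r ↦ ?_
    obtain ⟨k, hk, hkr⟩ := hfut (u + r)
      (Finset.mem_union_right _ (Finset.mem_image_of_mem _ r.2)) le_self_add
    have : (fun ω ↦ γ (u + r) ω - γ u ω) = fun ω ↦ ∑ i ∈ Finset.Ico m k, D i ω := by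
      ext ω
      rw [Finset.sum_Ico_sub (fun i ↦ γ (σ i) ω) hk, hkr, hσm]
    rw [this]
    exact Finset.measurable_fun_sum _ fun i hi ↦ hDmeas _ i (Finset.mem_Ico.1 hi).1
  · rw [← measurable_iff_comap_le]
    refine @measurable_pi_lambda _ _ _ (_) _ _ fun s ↦ ?_
    obtain ⟨k, hk, hks⟩ := hpast (min s u)
      (Finset.mem_union_left _ (Finset.mem_image_of_mem (fun s ↦ min s u) s.2)) (min_le_right _ _)
    have : (fun ω ↦ γ (min s u) ω - γ 0 ω) = fun ω ↦ ∑ i ∈ Finset.range k, D i ω := by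
      ext ω
      rw [Finset.sum_range_sub (fun i ↦ γ (σ i) ω), hks, hσ0]
    rw [this]
    exact Finset.measurable_fun_sum _ fun i hi ↦
      hDmeas _ i ((Finset.mem_range.1 hi).trans_le hk)

/-- The increments after `t` of a right-continuous process with independent increments are
independent of the events that depend, for every `s > t`, on the path up to time `s` only: they are
limits of increments after times `s > t`. -/
theorem indep_germSigma_futurePath (hm : ∀ t, Measurable (γ t)) (h0 : ∀ᵐ ω ∂P, γ 0 ω = 0)
    (hγ : HasIndepIncrements γ P) (hc : ∀ᵐ ω ∂P, IsCadlagPath (fun t ↦ γ t ω)) (t : ℝ≥0) :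
    Indep (MeasurableSpace.comap (fun ω t ↦ γ t ω) (germSigma t))
      (MeasurableSpace.comap (fun ω ↦ futurePath t (fun t ↦ γ t ω)) MeasurableSpace.pi) P := by
  set X : Ω → ℝ≥0 → ℝ := fun ω t ↦ γ t ω with hX
  have hXm : Measurable X := measurable_pi_lambda _ hm
  obtain ⟨s, hs_anti, hs_gt, hs_lim⟩ : ∃ s : ℕ → ℝ≥0, StrictAnti s ∧ (∀ n, t < s n) ∧
    Tendsto s atTop (𝓝 t) := exists_seq_strictAnti_tendsto t
  have hFm : ∀ n, Measurable (fun ω ↦ futurePath (s n) (X ω)) := fun n ↦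
    (measurable_futurePath _).comp hXm
  set σ : ℕ → MeasurableSpace Ω := fun n ↦
    MeasurableSpace.comap (fun ω ↦ futurePath (s n) (X ω)) MeasurableSpace.pi with hσ
  have hσmono : Monotone σ := by
    intro n k hnk
    rw [hσ]
    dsimp only
    rw [← measurable_iff_comap_le]
    refine @measurable_pi_lambda _ _ _ (_) _ _ fun r ↦ ?_
    have heq : (fun ω ↦ futurePath (s n) (X ω) r) = fun ω ↦
        futurePath (s k) (X ω) (s n - s k + r) - futurePath (s k) (X ω) (s n - s k) := by
      ext ω
      have h1 : s k + (s n - s k) = s n := add_tsub_cancel_of_le (hs_anti.antitone hnk)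
      simp [futurePath, ← add_assoc, h1]
    rw [heq]
    have hev : ∀ r, Measurable[MeasurableSpace.comap (fun ω ↦ futurePath (s k) (X ω))
        MeasurableSpace.pi] (fun ω ↦ futurePath (s k) (X ω) r) := fun r ↦
      (measurable_pi_apply r).comp (comap_measurable (fun ω ↦ futurePath (s k) (X ω)))
    exact (hev _).sub (hev _)
  have hind : Indep (⨆ n, σ n) (MeasurableSpace.comap X (germSigma t)) P := by
    refine indep_iSup_of_monotone (fun n ↦ ?_) (fun n ↦ (hFm n).comap_le)
      ((MeasurableSpace.comap_mono (germSigma_le_pi t)).trans hXm.comap_le) hσmono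
    have := (indepFun_stopPath_futurePath hm h0 hγ (s n)).symm
    rw [IndepFun_iff_Indep] at this
    refine indep_of_indep_of_le_right this ?_
    refine (MeasurableSpace.comap_mono (germSigma_le_pastSigma (hs_gt n))).trans ?_
    rw [pastSigma, MeasurableSpace.comap_comp]
    rfl
  set Y : Ω → ℝ≥0 → ℝ := fun ω r ↦
    limsup (fun n ↦ futurePath (s n) (X ω) (t + r - s n)) atTop with hY
  have hYm : Measurable[⨆ n, σ n] Y := by
    refine @measurable_pi_lambda _ _ _ (_) _ _ fun r ↦ ?_
    refine Measurable.limsup fun n ↦ ?_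
    exact ((measurable_pi_apply (t + r - s n)).comp
      (comap_measurable (fun ω ↦ futurePath (s n) (X ω)))).mono (le_iSup σ n) le_rfl
  have hYX : Y =ᵐ[P] fun ω ↦ futurePath t (X ω) := by
    filter_upwards [hc] with ω hω
    ext r
    have hright : Tendsto (fun n ↦ X ω (s n)) atTop (𝓝 (X ω t)) :=
      ((hω t).1.tendsto).comp (tendsto_nhdsWithin_iff.2
        ⟨hs_lim, Eventually.of_forall fun n ↦ (hs_gt n).le⟩)
    refine Tendsto.limsup_eq ?_
    rcases eq_or_ne r 0 with rfl | hr
    · have : ∀ n, t - s n = 0 := fun n ↦ tsub_eq_zero_of_le (hs_gt n).le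
      simp [futurePath, this]
    · have hlt : t < t + r := lt_add_of_pos_right t (pos_iff_ne_zero.2 hr)
      refine (hright.const_sub (X ω (t + r))).congr' ?_
      filter_upwards [hs_lim.eventually (gt_mem_nhds hlt)] with n hn
      simp [futurePath, add_tsub_cancel_of_le hn.le]
  rw [Indep_iff]
  rintro A _ hA ⟨B, hB, rfl⟩
  have hYB : Y ⁻¹' B =ᵐ[P] (fun ω ↦ futurePath t (X ω)) ⁻¹' B :=
    hYX.fun_comp (· ∈ B)
  have := (Indep_iff _ _ P).1 hind.symm A (Y ⁻¹' B) hA (hYm hB)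
  rwa [measure_congr hYB, measure_congr ((ae_eq_refl A).inter hYB)] at this

/-! ### The gamma bridge is independent of the terminal value -/

theorem IsStandardGammaProcess.isTiltDilation_map_sub (hγ : IsStandardGammaProcess γ P)
    {s t : ℝ≥0} (hst : s ≤ t) : IsTiltDilation (P.map (fun ω ↦ γ t ω - γ s ω)) := by
  rcases hst.eq_or_lt with rfl | h
  · simpa using isTiltDilation_dirac_zero
  · rw [(hγ.law_increments s t h).map_eq]
    exact isTiltDilation_gammaMeasure (by simpa using h)

/-- The normalized path `γ_{· ∧ u} / γ_u` of a gamma process is independent of `γ_u`. -/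
theorem IsStandardGammaProcess.indepFun_bridge (hγ : IsStandardGammaProcess γ P) (u : ℝ≥0) :
    IndepFun (fun ω s ↦ γ (min s u) ω / γ u ω) (γ u) P := by
  classical
  suffices h : IndepFun (fun ω s ↦ (γ (min s u) ω - γ 0 ω) / (γ u ω - γ 0 ω))
      (fun ω ↦ γ u ω - γ 0 ω) P by
    refine h.congr ?_ ?_
    all_goals
      filter_upwards [hγ.zero] with ω hω
      simp [hω]
  have hm := hγ.measurable
  refine IndepFun.process_indepFun
    (X := fun s ω ↦ (γ (min s u) ω - γ 0 ω) / (γ u ω - γ 0 ω))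
    (fun s ↦ ((hm _).sub (hm _)).div ((hm _).sub (hm _))) ((hm _).sub (hm _)) fun I ↦ ?_
  obtain ⟨σ, m, hσ, hσ0, hσm, hpast, -⟩ := exists_monotone_grid (I.image (fun s ↦ min s u)) u
  have hex : ∀ s : I, ∃ k ≤ m, σ k = min (s : ℝ≥0) u := fun s ↦
    hpast _ (Finset.mem_image_of_mem (fun s ↦ min s u) s.2) (min_le_right _ _)
  choose k hk hkσ using hex
  have hind : iIndepFun (fun (i : Fin m) ω ↦ γ (σ (i + 1)) ω - γ (σ i) ω) P :=
    (hγ.indep_increments.nat hσ).precomp Fin.val_injective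
  have hsum : ∀ ω, ∀ K ≤ m, ∑ i : Fin m, (if (i : ℕ) < K then γ (σ (i + 1)) ω - γ (σ i) ω else 0) =
      γ (σ K) ω - γ 0 ω := by
    intro ω K hK
    rw [Fin.sum_univ_eq_sum_range (fun i ↦ if i < K then γ (σ (i + 1)) ω - γ (σ i) ω else 0) m,
      ← Finset.sum_filter, ← hσ0, ← Finset.sum_range_sub (fun i ↦ γ (σ i) ω)]
    congr 1
    ext i
    simp only [Finset.mem_filter, Finset.mem_range]
    omega
  let g : (Fin m → ℝ) → I → ℝ := fun x s ↦
    (∑ i : Fin m, if (i : ℕ) < k s then x i else 0) / ∑ i, x i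
  have hg : Measurable g := by
    refine measurable_pi_lambda _ fun s ↦ Measurable.div ?_ (by fun_prop)
    refine Finset.measurable_fun_sum _ fun i _ ↦ ?_
    split_ifs
    · exact measurable_pi_apply i
    · exact measurable_const
  have hg_inv : ∀ r : ℝ, 0 < r → ∀ x, g (r • x) = g x := by
    intro r hr x
    ext s
    have h1 : ∀ i : Fin m, (if (i : ℕ) < k s then r * x i else 0) =
        r * if (i : ℕ) < k s then x i else 0 := fun i ↦ by split_ifs <;> simp
    simp only [g, Pi.smul_apply, smul_eq_mul, h1, ← Finset.mul_sum]
    rw [mul_div_mul_left _ _ hr.ne']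
  have := indepFun_sum_of_isTiltDilation (fun i ↦ (hm _).sub (hm _)) hind
    (fun i ↦ hγ.isTiltDilation_map_sub (hσ (Nat.le_succ i))) hg hg_inv
  have hS : ∀ ω, ∑ i : Fin m, (γ (σ (i + 1)) ω - γ (σ i) ω) = γ u ω - γ 0 ω := fun ω ↦ by
    simpa [hσm] using hsum ω m le_rfl
  refine this.congr (Eventually.of_forall fun ω ↦ ?_) (Eventually.of_forall hS)
  ext s
  simp only [g, Pi.sub_apply]
  rw [hsum ω _ (hk s), hS, hkσ s]

end IndependentIncrements

/-! ### Evaluation of a path at a random time -/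

/-- A point of the grid of step `1 / (n + 1)` lying strictly to the right of `r`, at distance at
most `1 / (n + 1)`. -/
noncomputable def gridAbove (n : ℕ) (r : ℝ≥0) : ℝ≥0 :=
  (⌊((n : ℝ≥0) + 1) * r⌋₊ + 1) / ((n : ℝ≥0) + 1)

theorem lt_gridAbove (n : ℕ) (r : ℝ≥0) : r < gridAbove n r := by
  rw [gridAbove, lt_div_iff₀ (by positivity), mul_comm]
  exact Nat.lt_floor_add_one _

theorem gridAbove_le (n : ℕ) (r : ℝ≥0) : gridAbove n r ≤ r + 1 / ((n : ℝ≥0) + 1) := by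
  have hn : (n : ℝ≥0) + 1 ≠ 0 := by positivity
  rw [gridAbove, div_le_iff₀ (by positivity), add_mul r, one_div_mul_cancel hn, mul_comm r]
  gcongr
  exact Nat.floor_le zero_le

theorem tendsto_gridAbove (r : ℝ≥0) : Tendsto (fun n ↦ gridAbove n r) atTop (𝓝[≥] r) := by
  refine tendsto_nhdsWithin_iff.2
    ⟨?_, Eventually.of_forall fun n ↦ (lt_gridAbove n r).le⟩
  refine tendsto_of_tendsto_of_tendsto_of_le_of_le tendsto_const_nhds ?_
    (fun n ↦ (lt_gridAbove n r).le) (fun n ↦ gridAbove_le n r)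
  simpa using (tendsto_one_div_add_atTop_nhds_zero_nat (𝕜 := ℝ≥0)).const_add r

/-- The value at `r` of a right-continuous path, written as a limit along countably many times so
that it is jointly measurable in the path and in `r`. -/
noncomputable def evalRight (x : ℝ≥0 → ℝ) (r : ℝ≥0) : ℝ :=
  limsup (fun n ↦ x (gridAbove n r)) atTop

theorem evalRight_eq {x : ℝ≥0 → ℝ} {r : ℝ≥0} (h : ContinuousWithinAt x (Set.Ici r) r) :
    evalRight x r = x r :=
  (h.tendsto.comp (tendsto_gridAbove r)).limsup_eq

theorem measurable_evalRight :
    Measurable (fun p : (ℝ≥0 → ℝ) × ℝ≥0 ↦ evalRight p.1 p.2) := by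
  refine Measurable.limsup fun n ↦ ?_
  have h1 : Measurable (fun p : (ℝ≥0 → ℝ) × ℕ ↦ p.1 (((p.2 : ℝ≥0) + 1) / ((n : ℝ≥0) + 1))) :=
    measurable_from_prod_countable_left fun k ↦
      measurable_pi_apply (((k : ℝ≥0) + 1) / ((n : ℝ≥0) + 1))
  have h2 : Measurable (fun p : (ℝ≥0 → ℝ) × ℝ≥0 ↦ (p.1, ⌊((n : ℝ≥0) + 1) * p.2⌋₊)) :=
    measurable_fst.prodMk (Nat.measurable_floor.comp (measurable_snd.const_mul _))
  exact h1.comp h2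

theorem Measurable.evalRight {α : Type*} [MeasurableSpace α] {x : α → ℝ≥0 → ℝ} {r : α → ℝ≥0}
    (hx : Measurable x) (hr : Measurable r) : Measurable (fun a ↦ evalRight (x a) (r a)) :=
  Measurable.comp (g := fun p : (ℝ≥0 → ℝ) × ℝ≥0 ↦ _root_.evalRight p.1 p.2)
    (f := fun a ↦ (x a, r a)) measurable_evalRight (hx.prodMk hr)

theorem IsCadlagPath.continuousWithinAt_futurePath {x : ℝ≥0 → ℝ} (hx : IsCadlagPath x)
    (u a : ℝ≥0) : ContinuousWithinAt (futurePath u x) (Set.Ici a) a := by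
  refine ContinuousWithinAt.sub ?_ continuousWithinAt_const
  refine ContinuousWithinAt.comp (t := Set.Ici (u + a)) (hx (u + a)).1
    (continuous_const.add continuous_id).continuousWithinAt fun b hb ↦ ?_
  exact add_le_add_right (α := ℝ≥0) hb u

theorem IsCadlagPath.evalRight_futurePath {x : ℝ≥0 → ℝ} (hx : IsCadlagPath x) {u r : ℝ≥0}
    (h : u ≤ r) : x u + evalRight (futurePath u x) (r - u) = x r := by
  rw [evalRight_eq (hx.continuousWithinAt_futurePath _ _), futurePath, add_tsub_cancel_of_le h]
  ring

/-! ### Path properties of the gamma bridge -/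

variable {τ : Ω → ℝ≥0}

theorem gammaMeasure_Iic_zero (a : ℝ) : gammaMeasure a 1 (Set.Iic 0) = 0 := by
  rw [gammaMeasure, withDensity_apply _ measurableSet_Iic, setLIntegral_congr Iio_ae_eq_Iic.symm,
    lintegral_gammaPDF_of_nonpos le_rfl]

/-- The paths of a gamma process are almost surely strictly increasing: the increment between any
two of the countably many rational times is positive. -/
theorem IsStandardGammaProcess.strictMono (hγ : IsStandardGammaProcess γ P) :
    ∀ᵐ ω ∂P, StrictMono (fun t ↦ γ t ω) := by
  have h : ∀ q r : ℚ, Real.toNNReal q < Real.toNNReal r →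
      ∀ᵐ ω ∂P, 0 < γ (Real.toNNReal r) ω - γ (Real.toNNReal q) ω := by
    intro q r hqr
    have hl := hγ.law_increments _ _ hqr
    have := gammaMeasure_Iic_zero ((Real.toNNReal r : ℝ) - (Real.toNNReal q : ℝ))
    have hm : Measurable fun ω ↦ γ (Real.toNNReal r) ω - γ (Real.toNNReal q) ω :=
      (hγ.measurable _).sub (hγ.measurable _)
    rw [← hl.map_eq, Measure.map_apply hm measurableSet_Iic] at this
    filter_upwards [measure_eq_zero_iff_ae_notMem.1 this] with ω hω
    simpa using hω
  simp_rw [eventually_imp_distrib_left.symm, ← ae_all_iff] at h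
  filter_upwards [h, hγ.monotone] with ω hω hmono s t hst
  obtain ⟨q, -, hsq, hqt⟩ := NNReal.lt_iff_exists_rat_btwn s t |>.1 hst
  obtain ⟨r, -, hqr, hrt⟩ := NNReal.lt_iff_exists_rat_btwn _ t |>.1 hqt
  have h1 := hω q r hqr
  have h2 := hmono hsq.le
  have h3 := hmono hrt.le
  dsimp only at h2 h3 ⊢
  linarith

/-- The bridge at a fixed time is measurable. Only almost all paths of `γ` are right continuous, so
that evaluation at the random time `τ` is measurable up to a null set; completeness does the
rest. -/
theorem measurable_gammaBridge [P.IsComplete] (hγ : IsStandardGammaProcess γ P)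
    (hτ : Measurable τ) (t : ℝ≥0) : Measurable (gammaBridge γ τ t) := by
  have hX : Measurable (fun ω t ↦ γ t ω) := measurable_pi_lambda _ hγ.measurable
  have hev := hX.evalRight hτ
  have hev' := hX.evalRight (measurable_const.min hτ : Measurable fun ω ↦ min t (τ ω))
  have hae : (fun ω ↦ evalRight (fun t ↦ γ t ω) (min t (τ ω)) / evalRight (fun t ↦ γ t ω) (τ ω))
      =ᵐ[P] gammaBridge γ τ t := by
    filter_upwards [hγ.cadlag] with ω hω
    rw [gammaBridge, evalRight_eq (hω _).1, evalRight_eq (hω _).1]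
  exact ((hev'.div hev).aemeasurable.congr hae).nullMeasurable.measurable_of_complete

section Regular

variable {ω : Ω}

theorem gammaBridge_eq_one (h0 : γ 0 ω = 0) (hmono : StrictMono (fun t ↦ γ t ω)) {t : ℝ≥0}
    (hτ : 0 < τ ω) (h : τ ω ≤ t) : gammaBridge γ τ t ω = 1 := by
  have : γ 0 ω < γ (τ ω) ω := hmono hτ
  rw [gammaBridge, min_eq_right h, div_self (by linarith)]

theorem gammaBridge_ne_one (h0 : γ 0 ω = 0) (hmono : StrictMono (fun t ↦ γ t ω)) {t : ℝ≥0}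
    (h : t < τ ω) : gammaBridge γ τ t ω ≠ 1 := by
  have h1 : γ 0 ω < γ (τ ω) ω := hmono (zero_le.trans_lt h)
  have h2 : γ t ω < γ (τ ω) ω := hmono h
  rw [gammaBridge, min_eq_left h.le, Ne, div_eq_one_iff_eq (by linarith)]
  exact h2.ne

/-- Before time `u < τ`, the gamma bridge is its value at `u` times the normalized gamma path. -/
theorem stopPath_gammaBridge (h0 : γ 0 ω = 0) (hmono : StrictMono (fun t ↦ γ t ω)) {u : ℝ≥0}
    (hu : 0 < u) (h : u < τ ω) :
    stopPath u (fun t ↦ gammaBridge γ τ t ω) =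
      fun s ↦ gammaBridge γ τ u ω * (γ (min s u) ω / γ u ω) := by
  have h1 : γ 0 ω < γ u ω := hmono hu
  ext s
  simp only [stopPath, gammaBridge, min_eq_left h.le, min_eq_left ((min_le_right s u).trans h.le)]
  field_simp [show γ u ω ≠ 0 by linarith]

theorem stopPath_eq_mul (h0 : γ 0 ω = 0) (hmono : StrictMono (fun t ↦ γ t ω)) {u : ℝ≥0}
    (hu : 0 < u) :
    stopPath u (fun t ↦ γ t ω) = fun s ↦ γ u ω * (γ (min s u) ω / γ u ω) := by
  have h1 : γ 0 ω < γ u ω := hmono hu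
  ext s
  simp only [stopPath]
  field_simp [show γ u ω ≠ 0 by linarith]

end Regular

/-- The value at time `r ≥ u` of the gamma bridge of length greater than `u`, as a function of the
value of the gamma process at `u`, of its increments after `u`, and of the length. -/
noncomputable def bridgeValue (u r : ℝ≥0) (p : ℝ × (ℝ≥0 → ℝ) × ℝ≥0) : ℝ :=
  (p.1 + evalRight p.2.1 (min r p.2.2 - u)) / (p.1 + evalRight p.2.1 (p.2.2 - u))

theorem measurable_bridgeValue (u r : ℝ≥0) : Measurable (bridgeValue u r) := by
  have h1 : Measurable (fun p : ℝ × (ℝ≥0 → ℝ) × ℝ≥0 ↦ evalRight p.2.1 (min r p.2.2 - u)) :=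
    Measurable.evalRight (by fun_prop) (by fun_prop)
  have h2 : Measurable (fun p : ℝ × (ℝ≥0 → ℝ) × ℝ≥0 ↦ evalRight p.2.1 (p.2.2 - u)) :=
    Measurable.evalRight (by fun_prop) (by fun_prop)
  exact (measurable_fst.add h1).div (measurable_fst.add h2)

theorem gammaBridge_eq_bridgeValue {ω : Ω} (hc : IsCadlagPath (fun t ↦ γ t ω)) {u r : ℝ≥0}
    (hu : u < τ ω) (hr : u ≤ r) :
    gammaBridge γ τ r ω = bridgeValue u r (γ u ω, futurePath u (fun t ↦ γ t ω), τ ω) := by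
  have h1 := hc.evalRight_futurePath (le_min hr hu.le)
  have h2 := hc.evalRight_futurePath hu.le
  simp only [bridgeValue, gammaBridge]
  rw [h1, h2]

/-! ### Absolute continuity of the bridge at a fixed time -/

/-- The map `x ↦ x / (x + g)` pulls back null sets of a gamma law to null sets. -/
theorem gammaMeasure_preimage_div_add {a g : ℝ} (ha : 0 < a) (hg : 0 < g) {N : Set ℝ}
    (hN : gammaMeasure a 1 N = 0) : gammaMeasure a 1 {x | x / (x + g) ∈ N} = 0 := by
  have hmp : Measurable (gammaPDF a 1) := (measurable_gammaPDFReal a 1).ennreal_ofReal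
  have hvol : volume (N ∩ Set.Ioo 0 1) = 0 := by
    rw [gammaMeasure, withDensity_apply_eq_zero' hmp.aemeasurable] at hN
    refine measure_mono_null (t := {x | gammaPDF a 1 x ≠ 0} ∩ N) (fun x hx ↦ ⟨?_, hx.1⟩) hN
    simpa [gammaPDF] using gammaPDFReal_pos ha one_pos hx.2.1
  have himage : volume ((fun y ↦ g * y / (1 - y)) '' (N ∩ Set.Ioo 0 1)) = 0 := by
    refine addHaar_image_eq_zero_of_differentiableOn_of_addHaar_eq_zero _ (fun y hy ↦ ?_) hvol
    have : 1 - y ≠ 0 := by linarith [hy.2.2]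
    exact DifferentiableAt.differentiableWithinAt (by fun_prop (disch := exact this))
  have hac : gammaMeasure a 1 ≪ volume := withDensity_absolutelyContinuous _ _
  refine measure_mono_null (t := Set.Iic 0 ∪ (fun y ↦ g * y / (1 - y)) '' (N ∩ Set.Ioo 0 1))
    (fun x hx ↦ ?_) (measure_union_null (gammaMeasure_Iic_zero a) (hac himage))
  rcases le_or_gt x 0 with h | h
  · exact Or.inl h
  · refine Or.inr ⟨x / (x + g), ⟨hx, by positivity, ?_⟩, ?_⟩
    · rw [div_lt_one (by positivity)]
      linarith
    · have h1 : 1 - x / (x + g) = g / (x + g) := by field_simp; ring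
      simp only [h1]
      field_simp

variable [IsProbabilityMeasure P]

/-! ### Comparison of the bridge with the gamma process -/

theorem indepFun_prodMk_of_indepFun_prodMk {α β δ : Type*} [MeasurableSpace α]
    [MeasurableSpace β] [MeasurableSpace δ] {f : Ω → α} {g : Ω → β} {h : Ω → δ}
    (hf : Measurable f) (hg : Measurable g) (hh : Measurable h) (hfg : IndepFun f g P)
    (hfgh : IndepFun (fun ω ↦ (f ω, g ω)) h P) : IndepFun f (fun ω ↦ (g ω, h ω)) P := by
  have := Measure.isProbabilityMeasure_map (μ := P) hf.aemeasurable
  have := Measure.isProbabilityMeasure_map (μ := P) hg.aemeasurable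
  have := Measure.isProbabilityMeasure_map (μ := P) hh.aemeasurable
  have hgh : IndepFun g h P := hfgh.comp (φ := Prod.snd) (ψ := id) measurable_snd measurable_id
  rw [indepFun_iff_map_prod_eq_prod_map_map hf.aemeasurable hg.aemeasurable] at hfg
  rw [indepFun_iff_map_prod_eq_prod_map_map (hf.prodMk hg).aemeasurable hh.aemeasurable] at hfgh
  rw [indepFun_iff_map_prod_eq_prod_map_map hg.aemeasurable hh.aemeasurable] at hgh
  rw [indepFun_iff_map_prod_eq_prod_map_map hf.aemeasurable (hg.prodMk hh).aemeasurable, hgh,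
    ← Measure.prodAssoc_prod, ← hfg, ← hfgh, Measure.map_map (by fun_prop) (by fun_prop)]
  rfl

theorem setLIntegral_preimage_eq_lintegral_indicator_mul {α : Type*} [MeasurableSpace α]
    {μ : Measure Ω} {f : Ω → α} (hf : Measurable f) {A : Set α} (hA : MeasurableSet A)
    (g : Ω → ℝ≥0∞) : ∫⁻ ω in f ⁻¹' A, g ω ∂μ = ∫⁻ ω, A.indicator 1 (f ω) * g ω ∂μ := by
  rw [← lintegral_indicator (hf hA)]
  refine lintegral_congr fun ω ↦ ?_
  by_cases h : f ω ∈ A <;> simp [h, Set.indicator]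

theorem IsStandardGammaProcess.indepFun_stopPath_prodMk (hγ : IsStandardGammaProcess γ P)
    (hτ : Measurable τ) (hindep : IndepFun τ (fun ω t ↦ γ t ω) P) (u : ℝ≥0) :
    IndepFun (fun ω ↦ stopPath u (fun t ↦ γ t ω))
      (fun ω ↦ (futurePath u (fun t ↦ γ t ω), τ ω)) P := by
  have hX : Measurable (fun ω t ↦ γ t ω) := measurable_pi_lambda _ hγ.measurable
  refine indepFun_prodMk_of_indepFun_prodMk ((measurable_stopPath u).comp hX)
    ((measurable_futurePath u).comp hX) hτ
    (indepFun_stopPath_futurePath hγ.measurable hγ.zero hγ.indep_increments u) ?_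
  exact hindep.symm.comp (φ := fun x ↦ (stopPath u x, futurePath u x)) (ψ := id)
    ((measurable_stopPath u).prodMk (measurable_futurePath u)) measurable_id

/-- The normalized path up to time `u` is independent of everything else: the value at `u`, the
increments after `u`, and the random length. -/
theorem IsStandardGammaProcess.indepFun_bridge_prodMk (hγ : IsStandardGammaProcess γ P)
    (hτ : Measurable τ) (hindep : IndepFun τ (fun ω t ↦ γ t ω) P) (u : ℝ≥0) :
    IndepFun (fun ω s ↦ γ (min s u) ω / γ u ω)
      (fun ω ↦ (γ u ω, futurePath u (fun t ↦ γ t ω), τ ω)) P := by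
  have hX : Measurable (fun ω t ↦ γ t ω) := measurable_pi_lambda _ hγ.measurable
  have hfut := (measurable_futurePath u).comp hX
  have h1 := hγ.indepFun_stopPath_prodMk hτ hindep u
  refine indepFun_prodMk_of_indepFun_prodMk
    (measurable_pi_lambda _ fun s ↦ (hγ.measurable _).div (hγ.measurable _)) (hγ.measurable u)
    (hfut.prodMk hτ) (hγ.indepFun_bridge u) ?_
  have hφ : Measurable (fun x : ℝ≥0 → ℝ ↦ ((fun s ↦ x s / x u : ℝ≥0 → ℝ), x u)) :=
    (measurable_pi_lambda _ fun s ↦ (measurable_pi_apply s).div (measurable_pi_apply u)).prodMk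
      (measurable_pi_apply u)
  have h2 := h1.comp hφ measurable_id
  simpa [Function.comp_def, stopPath] using h2

/-- On `{u < τ}` the law of the bridge at time `u` is absolutely continuous with respect to that of
`γ_u`: it is the image of the latter under `x ↦ x / (x + g)`, where `g = γ_τ - γ_u` is positive and
independent of `γ_u`. -/
theorem IsStandardGammaProcess.ae_gammaBridge_notMem (hγ : IsStandardGammaProcess γ P)
    (hτ : Measurable τ) (hindep : IndepFun τ (fun ω t ↦ γ t ω) P) {u : ℝ≥0} (hu : 0 < u)
    {N : Set ℝ} (hN : MeasurableSet N) (hN0 : P.map (γ u) N = 0) :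
    ∀ᵐ ω ∂P, u < τ ω →
      bridgeValue u u (γ u ω, futurePath u (fun t ↦ γ t ω), τ ω) ∉ N := by
  have hX : Measurable (fun ω t ↦ γ t ω) := measurable_pi_lambda _ hγ.measurable
  have hfut : Measurable (fun ω ↦ futurePath u (fun t ↦ γ t ω)) :=
    (measurable_futurePath u).comp hX
  have hG : Measurable (fun ω ↦ evalRight (futurePath u (fun t ↦ γ t ω)) (τ ω - u)) :=
    hfut.evalRight (hτ.sub_const u)
  have hind : IndepFun (fun ω ↦ evalRight (futurePath u (fun t ↦ γ t ω)) (τ ω - u)) (γ u) P := by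
    have h1 := hγ.indepFun_stopPath_prodMk hτ hindep u
    have heval : Measurable (fun x : ℝ≥0 → ℝ ↦ x u) := measurable_pi_apply u
    have h2 := h1.symm.comp (φ := fun p : (ℝ≥0 → ℝ) × ℝ≥0 ↦ evalRight p.1 (p.2 - u))
      (ψ := fun x : ℝ≥0 → ℝ ↦ x u) (Measurable.evalRight (by fun_prop) (by fun_prop)) heval
    simpa [Function.comp_def, stopPath] using h2
  have hlaw : P.map (γ u) = gammaMeasure u 1 := by
    have := (hγ.law_increments 0 u hu).map_eq
    rw [NNReal.coe_zero, sub_zero] at this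
    rw [← this]
    refine Measure.map_congr ?_
    filter_upwards [hγ.zero] with ω hω
    simp [hω]
  have hmap := (indepFun_iff_map_prod_eq_prod_map_map hG.aemeasurable
    (hγ.measurable u).aemeasurable).1 hind
  set S : Set (ℝ × ℝ) := {p | 0 < p.1 ∧ p.2 / (p.2 + p.1) ∈ N} with hS
  have hSm : MeasurableSet S := by
    have h2 : Measurable fun p : ℝ × ℝ ↦ p.2 / (p.2 + p.1) := by fun_prop
    exact (measurableSet_lt measurable_const measurable_fst).inter (h2 hN)
  have hS0 : P.map (fun ω ↦ (evalRight (futurePath u (fun t ↦ γ t ω)) (τ ω - u), γ u ω)) S = 0 := by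
    have := Measure.isProbabilityMeasure_map (μ := P) (hγ.measurable u).aemeasurable
    rw [hmap, Measure.measure_prod_null hSm]
    refine Eventually.of_forall fun g ↦ ?_
    rw [hlaw] at hN0 ⊢
    by_cases hg : 0 < g
    · exact measure_mono_null (fun x hx ↦ hx.2)
        (gammaMeasure_preimage_div_add (by simpa using hu) hg hN0)
    · exact measure_mono_null (t := ∅) (fun x hx ↦ absurd hx.1 hg) measure_empty
  rw [Measure.map_apply (hG.prodMk (hγ.measurable u)) hSm] at hS0
  filter_upwards [measure_eq_zero_iff_ae_notMem.1 hS0, hγ.cadlag, hγ.strictMono]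
    with ω hω hc hmono huτ hmem
  refine hω ⟨?_, ?_⟩
  · have h1 := hc.evalRight_futurePath huτ.le
    have h2 : γ u ω < γ (τ ω) ω := hmono huτ
    dsimp only at h1 ⊢
    linarith
  · have h1 := hc.evalRight_futurePath (le_refl u)
    rw [tsub_self, add_eq_left] at h1
    simpa [bridgeValue, min_eq_left huτ.le, h1] using hmem

/-- On `{u < τ}`, and with any bounded weight that depends on `γ_u`, on the increments of `γ` after
`u` and on `τ`, the law of the bridge up to time `u` has a density with respect to that of the
gamma process up to time `u`, and this density depends on the value of the path at `u` only: both
paths are their value at `u` times the same independent normalized path. -/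
theorem IsStandardGammaProcess.exists_density_gammaBridge (hγ : IsStandardGammaProcess γ P)
    (hτ : Measurable τ) (hindep : IndepFun τ (fun ω t ↦ γ t ω) P)
    (hζ : ∀ t, Measurable (gammaBridge γ τ t)) {u : ℝ≥0} (hu : 0 < u)
    {w : ℝ × (ℝ≥0 → ℝ) × ℝ≥0 → ℝ≥0∞} (hw : Measurable w) {C : ℝ≥0∞} (hC : C ≠ ∞)
    (hwC : ∀ p, w p ≤ C) (hw0 : ∀ p, p.2.2 ≤ u → w p = 0) :
    ∃ Φ : ℝ → ℝ≥0∞, Measurable Φ ∧ ∀ A, MeasurableSet[pastSigma u] A →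
      ∫⁻ ω in (fun ω t ↦ gammaBridge γ τ t ω) ⁻¹' A,
        w (γ u ω, futurePath u (fun t ↦ γ t ω), τ ω) ∂P =
      ∫⁻ ω in (fun ω t ↦ γ t ω) ⁻¹' A, Φ (γ u ω) ∂P := by
  have hX : Measurable (fun ω t ↦ γ t ω) := measurable_pi_lambda _ hγ.measurable
  have hZ : Measurable (fun ω t ↦ gammaBridge γ τ t ω) := measurable_pi_lambda _ hζ
  have hfut : Measurable (fun ω ↦ futurePath u (fun t ↦ γ t ω)) :=
    (measurable_futurePath u).comp hX
  set V : Ω → ℝ × (ℝ≥0 → ℝ) × ℝ≥0 := fun ω ↦ (γ u ω, futurePath u (fun t ↦ γ t ω), τ ω) with hV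
  have hVm : Measurable V := (hγ.measurable u).prodMk (hfut.prodMk hτ)
  set b : Ω → ℝ≥0 → ℝ := fun ω s ↦ γ (min s u) ω / γ u ω with hb
  have hbm : Measurable b :=
    measurable_pi_lambda _ fun s ↦ (hγ.measurable _).div (hγ.measurable _)
  have hprobV := Measure.isProbabilityMeasure_map (μ := P) hVm.aemeasurable
  have hprobb := Measure.isProbabilityMeasure_map (μ := P) hbm.aemeasurable
  have hprobu := Measure.isProbabilityMeasure_map (μ := P) (hγ.measurable u).aemeasurable
  have hbV := (indepFun_iff_map_prod_eq_prod_map_map hbm.aemeasurable hVm.aemeasurable).1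
    (hγ.indepFun_bridge_prodMk hτ hindep u)
  have hbu := (indepFun_iff_map_prod_eq_prod_map_map hbm.aemeasurable
    (hγ.measurable u).aemeasurable).1 (hγ.indepFun_bridge u)
  have hz : Measurable (bridgeValue u u) := measurable_bridgeValue u u
  set ν : Measure ℝ := ((P.map V).withDensity w).map (bridgeValue u u) with hν
  have hfin : IsFiniteMeasure ((P.map V).withDensity w) := by
    refine isFiniteMeasure_withDensity (ne_top_of_le_ne_top hC ?_)
    calc ∫⁻ p, w p ∂(P.map V) ≤ ∫⁻ p, C ∂(P.map V) := lintegral_mono hwC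
      _ = C := by simp
  have hac : ν ≪ P.map (γ u) := by
    refine Measure.AbsolutelyContinuous.mk fun N hN hN0 ↦ ?_
    rw [hν, Measure.map_apply hz hN, withDensity_apply _ (hz hN), setLIntegral_map (hz hN) hw hVm]
    refine (setLIntegral_eq_zero_iff ((hz.comp hVm) hN) (hw.comp hVm)).2 ?_
    filter_upwards [hγ.ae_gammaBridge_notMem hτ hindep hu hN hN0] with ω hω hmem
    by_cases huτ : u < τ ω
    · exact absurd hmem (hω huτ)
    · exact hw0 _ (not_lt.1 huτ)
  refine ⟨ν.rnDeriv (P.map (γ u)), Measure.measurable_rnDeriv _ _, ?_⟩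
  rintro _ ⟨A, hA, rfl⟩
  have hM : Measurable (fun p : ℝ × (ℝ≥0 → ℝ) ↦ fun s ↦ p.1 * p.2 s) :=
    measurable_pi_lambda _ fun s ↦
      measurable_fst.mul ((measurable_pi_apply s).comp measurable_snd)
  set I : ℝ × (ℝ≥0 → ℝ) → ℝ≥0∞ := fun p ↦ A.indicator 1 (fun s ↦ p.1 * p.2 s) with hI
  have hIm : Measurable I := (measurable_one.indicator hA).comp hM
  have hIy : ∀ y, Measurable (fun x ↦ I (y, x)) := fun y ↦ hIm.comp measurable_prodMk_left
  set F : ℝ → ℝ≥0∞ := fun y ↦ ∫⁻ x, I (y, x) ∂(P.map b) with hF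
  have hFm : Measurable F := hIm.lintegral_prod_right'
  have hleft : ∫⁻ ω in (fun ω t ↦ gammaBridge γ τ t ω) ⁻¹' (stopPath u ⁻¹' A), w (V ω) ∂P =
      ∫⁻ y, F y ∂ν := by
    calc _ = ∫⁻ ω, I (bridgeValue u u (V ω), b ω) * w (V ω) ∂P := by
          rw [setLIntegral_preimage_eq_lintegral_indicator_mul hZ (measurable_stopPath u hA)]
          refine lintegral_congr_ae ?_
          filter_upwards [hγ.cadlag, hγ.strictMono, hγ.zero] with ω hc hmono h0
          by_cases huτ : u < τ ω
          · have h1 := stopPath_gammaBridge (τ := τ) h0 hmono hu huτ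
            rw [gammaBridge_eq_bridgeValue hc huτ le_rfl] at h1
            have h2 : I (bridgeValue u u (V ω), b ω) =
                A.indicator 1 (stopPath u (fun t ↦ gammaBridge γ τ t ω)) := by
              rw [h1]
            rw [h2]
            rfl
          · rw [hw0 (V ω) (not_lt.1 huτ), mul_zero, mul_zero]
      _ = ∫⁻ q, I (bridgeValue u u q.2, q.1) * w q.2 ∂((P.map b).prod (P.map V)) := by
          rw [← hbV, lintegral_map ?_ (hbm.prodMk hVm)]
          exact (hIm.comp ((hz.comp measurable_snd).prodMk measurable_fst)).mul
            (hw.comp measurable_snd)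
      _ = ∫⁻ p, F (bridgeValue u u p) * w p ∂(P.map V) := by
          rw [lintegral_prod_symm']
          · exact lintegral_congr fun p ↦ lintegral_mul_const (w p)
              (hIy (bridgeValue u u p))
          · exact (hIm.comp ((hz.comp measurable_snd).prodMk measurable_fst)).mul
              (hw.comp measurable_snd)
      _ = ∫⁻ y, F y ∂ν := by
          rw [hν, lintegral_map hFm hz]
          refine ((lintegral_withDensity_eq_lintegral_mul _ hw (hFm.comp hz)).trans ?_).symm
          exact lintegral_congr fun p ↦ mul_comm _ _
  have hright : ∫⁻ ω in (fun ω t ↦ γ t ω) ⁻¹' (stopPath u ⁻¹' A),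
      ν.rnDeriv (P.map (γ u)) (γ u ω) ∂P = ∫⁻ y, F y ∂ν := by
    have hΦ := Measure.measurable_rnDeriv ν (P.map (γ u))
    calc _ = ∫⁻ ω, ν.rnDeriv (P.map (γ u)) (γ u ω) * I (γ u ω, b ω) ∂P := by
          rw [setLIntegral_preimage_eq_lintegral_indicator_mul hX (measurable_stopPath u hA)]
          refine lintegral_congr_ae ?_
          filter_upwards [hγ.strictMono, hγ.zero] with ω hmono h0
          have h1 := stopPath_eq_mul h0 hmono hu
          have h2 : I (γ u ω, b ω) = A.indicator 1 (stopPath u (fun t ↦ γ t ω)) := by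
            rw [h1]
          rw [h2, mul_comm]
          rfl
      _ = ∫⁻ q, ν.rnDeriv (P.map (γ u)) q.2 * I (q.2, q.1)
            ∂((P.map b).prod (P.map (γ u))) := by
          rw [← hbu, lintegral_map ?_ (hbm.prodMk (hγ.measurable u))]
          exact (hΦ.comp measurable_snd).mul (hIm.comp measurable_swap)
      _ = ∫⁻ y, ν.rnDeriv (P.map (γ u)) y * F y ∂(P.map (γ u)) := by
          rw [lintegral_prod_symm']
          · exact lintegral_congr fun y ↦ lintegral_const_mul
              (ν.rnDeriv (P.map (γ u)) y) (hIy y)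
          · exact (hΦ.comp measurable_snd).mul (hIm.comp measurable_swap)
      _ = ∫⁻ y, F y ∂ν := lintegral_rnDeriv_mul hac hFm.aemeasurable
  rw [hleft, hright]

/-- The gamma process is Markov with respect to its right-continuous filtration: integrating out
the increment of the process between `t` and `u`. -/
theorem IsStandardGammaProcess.exists_lintegral_germSigma (hγ : IsStandardGammaProcess γ P)
    {t u : ℝ≥0} (htu : t ≤ u) {Φ : ℝ → ℝ≥0∞} (hΦ : Measurable Φ) :
    ∃ k : ℝ → ℝ≥0∞, Measurable k ∧ ∀ A, MeasurableSet[germSigma t] A →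
      ∫⁻ ω in (fun ω t ↦ γ t ω) ⁻¹' A, Φ (γ u ω) ∂P =
      ∫⁻ ω in (fun ω t ↦ γ t ω) ⁻¹' A, k (γ t ω) ∂P := by
  have hX : Measurable (fun ω t ↦ γ t ω) := measurable_pi_lambda _ hγ.measurable
  have hDm : Measurable (fun ω ↦ γ u ω - γ t ω) := (hγ.measurable u).sub (hγ.measurable t)
  have hprob := Measure.isProbabilityMeasure_map (μ := P) hDm.aemeasurable
  refine ⟨fun x ↦ ∫⁻ d, Φ (x + d) ∂(P.map (fun ω ↦ γ u ω - γ t ω)),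
    (hΦ.comp (measurable_fst.add measurable_snd)).lintegral_prod_right', fun A hA ↦ ?_⟩
  have hA' : MeasurableSet A := germSigma_le_pi t A hA
  set f : Ω → ℝ≥0∞ × ℝ := fun ω ↦ (A.indicator 1 (fun t ↦ γ t ω), γ t ω) with hf
  have hfm : Measurable f :=
    ((measurable_one.indicator hA').comp hX).prodMk (hγ.measurable t)
  have hind : IndepFun f (fun ω ↦ γ u ω - γ t ω) P := by
    rw [IndepFun_iff_Indep]
    refine indep_of_indep_of_le_left (indep_of_indep_of_le_right
      (indep_germSigma_futurePath hγ.measurable hγ.zero hγ.indep_increments hγ.cadlag t) ?_) ?_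
    · rw [← measurable_iff_comap_le]
      have : (fun ω ↦ γ u ω - γ t ω) = fun ω ↦ futurePath t (fun t ↦ γ t ω) (u - t) := by
        ext ω
        rw [futurePath, add_tsub_cancel_of_le htu]
      rw [this]
      exact (measurable_pi_apply (u - t)).comp
        (comap_measurable (fun ω ↦ futurePath t (fun t ↦ γ t ω)))
    · rw [← measurable_iff_comap_le]
      have h1 : Measurable[germSigma t] (A.indicator (fun _ ↦ (1 : ℝ≥0∞))) :=
        @Measurable.indicator _ _ A _ (germSigma t) _ _
          (@measurable_const _ _ _ (germSigma t) (1 : ℝ≥0∞)) hA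
      have h2 : Measurable[germSigma t]
          (fun x : ℝ≥0 → ℝ ↦ (A.indicator (fun _ ↦ (1 : ℝ≥0∞)) x, x t)) :=
        h1.prodMk (measurable_eval_germSigma t)
      exact @Measurable.comp _ _ _ (_) (germSigma t) _ _ _ h2
        (@comap_measurable _ _ (germSigma t) (fun ω t ↦ γ t ω))
  have hmap := (indepFun_iff_map_prod_eq_prod_map_map hfm.aemeasurable hDm.aemeasurable).1 hind
  have hprobf := Measure.isProbabilityMeasure_map (μ := P) hfm.aemeasurable
  have hG : Measurable (fun q : (ℝ≥0∞ × ℝ) × ℝ ↦ q.1.1 * Φ (q.1.2 + q.2)) := by fun_prop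
  calc ∫⁻ ω in (fun ω t ↦ γ t ω) ⁻¹' A, Φ (γ u ω) ∂P
      = ∫⁻ ω, (f ω).1 * Φ ((f ω).2 + (γ u ω - γ t ω)) ∂P := by
        rw [setLIntegral_preimage_eq_lintegral_indicator_mul hX hA']
        exact lintegral_congr fun ω ↦ by simp [hf]
    _ = ∫⁻ q, q.1.1 * Φ (q.1.2 + q.2) ∂((P.map f).prod (P.map (fun ω ↦ γ u ω - γ t ω))) := by
        rw [← hmap, lintegral_map hG (hfm.prodMk hDm)]
    _ = ∫⁻ p, p.1 * ∫⁻ d, Φ (p.2 + d) ∂(P.map (fun ω ↦ γ u ω - γ t ω)) ∂(P.map f) := by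
        rw [lintegral_prod _ hG.aemeasurable]
        exact lintegral_congr fun p ↦ lintegral_const_mul p.1 (by fun_prop)
    _ = _ := by
        rw [setLIntegral_preimage_eq_lintegral_indicator_mul hX hA', lintegral_map ?_ hfm]
        exact measurable_fst.mul
          ((hΦ.comp (measurable_fst.add measurable_snd)).lintegral_prod_right'.comp measurable_snd)

/-- On `{t < τ}`, weighted by a bounded function of a later value of the bridge, the law of the
bridge on the germ `σ`-algebra at `t` has a density with respect to that of the gamma process, and
this density depends on the value of the path at `t` only. -/
theorem IsStandardGammaProcess.exists_lintegral_gammaBridge (hγ : IsStandardGammaProcess γ P)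
    (hτ : Measurable τ) (hindep : IndepFun τ (fun ω t ↦ γ t ω) P)
    (hζ : ∀ t, Measurable (gammaBridge γ τ t)) {t s : ℝ≥0} (hts : t < s)
    {f : ℝ → ℝ≥0∞} (hf : Measurable f) {C : ℝ≥0∞} (hC : C ≠ ∞) (hfC : ∀ x, f x ≤ C) :
    ∃ k : ℝ → ℝ≥0∞, Measurable k ∧ ∀ A, MeasurableSet[germSigma t] A →
      ∫⁻ ω in (fun ω t ↦ gammaBridge γ τ t ω) ⁻¹' A ∩ {ω | t < τ ω}, f (gammaBridge γ τ s ω) ∂P =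
      ∫⁻ ω in (fun ω t ↦ γ t ω) ⁻¹' A, k (γ t ω) ∂P := by
  have hZ : Measurable (fun ω t ↦ gammaBridge γ τ t ω) := measurable_pi_lambda _ hζ
  obtain ⟨u, hu_anti, hu_mem, hu_lim⟩ : ∃ u : ℕ → ℝ≥0, StrictAnti u ∧ (∀ n, u n ∈ Set.Ioo t s) ∧
    Tendsto u atTop (𝓝 t) := exists_seq_strictAnti_tendsto' hts
  -- The event `{t < τ}` is cut into pieces on each of which `τ` exceeds some `u n > t`.
  set S : ℕ → Set ℝ≥0 := disjointed (fun n ↦ Set.Ioi (u n)) with hS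
  have hSm : ∀ n, MeasurableSet (S n) := fun n ↦
    MeasurableSet.disjointed (fun _ ↦ measurableSet_Ioi) n
  have hSu : ∀ n, S n ⊆ Set.Ioi (u n) := fun n ↦ disjointed_subset _ n
  have hSU : ⋃ n, S n = Set.Ioi t := by
    rw [hS, iUnion_disjointed]
    ext r
    simp only [Set.mem_iUnion, Set.mem_Ioi]
    exact ⟨fun ⟨n, hn⟩ ↦ (hu_mem n).1.trans hn,
      fun hr ↦ (hu_lim.eventually (gt_mem_nhds hr)).exists⟩
  have hpiece : ∀ n, ∃ k : ℝ → ℝ≥0∞, Measurable k ∧ ∀ A, MeasurableSet[germSigma t] A →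
      ∫⁻ ω in (fun ω t ↦ gammaBridge γ τ t ω) ⁻¹' A ∩ τ ⁻¹' S n, f (gammaBridge γ τ s ω) ∂P =
      ∫⁻ ω in (fun ω t ↦ γ t ω) ⁻¹' A, k (γ t ω) ∂P := by
    intro n
    have hun : 0 < u n := zero_le.trans_lt (hu_mem n).1
    have hwm : Measurable (fun p : ℝ × (ℝ≥0 → ℝ) × ℝ≥0 ↦
        (S n).indicator 1 p.2.2 * f (bridgeValue (u n) s p)) :=
      ((measurable_one.indicator (hSm n)).comp (measurable_snd.comp measurable_snd)).mul
        (hf.comp (measurable_bridgeValue (u n) s))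
    obtain ⟨Φ, hΦ, hΦeq⟩ := hγ.exists_density_gammaBridge hτ hindep hζ hun hwm hC
      (fun p ↦ by
        by_cases h : p.2.2 ∈ S n
        · simpa [h] using hfC _
        · simp [h])
      (fun p hp ↦ by
        have : p.2.2 ∉ S n := fun h ↦ absurd (hSu n h) (not_lt.2 hp)
        simp [this])
    obtain ⟨k, hk, hkeq⟩ := hγ.exists_lintegral_germSigma (hu_mem n).1.le hΦ
    refine ⟨k, hk, fun A hA ↦ ?_⟩
    rw [← hkeq A hA, ← hΦeq A (germSigma_le_pastSigma (hu_mem n).1 A hA), Set.inter_comm,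
      ← setLIntegral_indicator (hτ (hSm n))]
    refine lintegral_congr_ae (ae_restrict_of_ae ?_)
    filter_upwards [hγ.cadlag] with ω hc
    by_cases h : τ ω ∈ S n
    · rw [Set.indicator_of_mem (by exact h), Set.indicator_of_mem h,
        gammaBridge_eq_bridgeValue hc (hSu n h) (hu_mem n).2.le, Pi.one_apply, one_mul]
    · rw [Set.indicator_of_notMem (by exact h), Set.indicator_of_notMem h, zero_mul]
  choose k hk hkeq using hpiece
  refine ⟨fun x ↦ ∑' n, k n x, Measurable.tsum hk, fun A hA ↦ ?_⟩
  have hA' : MeasurableSet A := germSigma_le_pi t A hA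
  have hset : (fun ω t ↦ gammaBridge γ τ t ω) ⁻¹' A ∩ {ω | t < τ ω} =
      ⋃ n, (fun ω t ↦ gammaBridge γ τ t ω) ⁻¹' A ∩ τ ⁻¹' S n := by
    rw [← Set.inter_iUnion, ← Set.preimage_iUnion, hSU]
    rfl
  rw [hset, lintegral_iUnion (fun n ↦ (hZ hA').inter (hτ (hSm n)))]
  · exact (tsum_congr fun n ↦ hkeq n A hA).trans
      (lintegral_tsum fun n ↦ ((hk n).comp (hγ.measurable t)).aemeasurable).symm
  · intro i j hij
    exact ((disjoint_disjointed _ hij).preimage τ).mono Set.inter_subset_right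
      Set.inter_subset_right

/-! ### The augmented filtration and the germ `σ`-algebra -/

/-- Up to a null set, an event of the usual augmentation at time `t` is a germ event of the path:
it agrees almost surely with an event depending on the path up to time `s n`, for each `n`, and
hence with the upper limit of these events. -/
theorem exists_germSigma_ae_eq {P : Measure Ω} [P.IsComplete] {Y : ℝ≥0 → Ω → ℝ}
    (hY : ∀ t, StronglyMeasurable (Y t)) {t : ℝ≥0} {A : Set Ω}
    (hA : MeasurableSet[usualAugmentation P (Filtration.natural Y hY) t] A) :
    ∃ B, MeasurableSet[germSigma t] B ∧ A =ᵐ[P] (fun ω t ↦ Y t ω) ⁻¹' B := by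
  obtain ⟨s, hs_anti, hs_gt, hs_lim⟩ : ∃ s : ℕ → ℝ≥0, StrictAnti s ∧ (∀ n, t < s n) ∧
    Tendsto s atTop (𝓝 t) := exists_seq_strictAnti_tendsto t
  rw [usualAugmentation, Filtration.rightCont_eq] at hA
  have hstep : ∀ n, ∃ B, MeasurableSet[pastSigma (s n)] B ∧ A =ᵐ[P] (fun ω t ↦ Y t ω) ⁻¹' B := by
    intro n
    have h1 : MeasurableSet[completedFiltration P (Filtration.natural Y hY) (s n)] A :=
      (iInf₂_le (f := fun j (_ : j > t) ↦ completedFiltration P (Filtration.natural Y hY) j)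
        (s n) (hs_gt n)) A hA
    have h2 : (completedFiltration P (Filtration.natural Y hY) (s n) : MeasurableSpace Ω) ≤
        eventuallyMeasurableSpace
          (MeasurableSpace.comap (fun ω t ↦ Y t ω) (pastSigma (s n))) (ae P) := by
      refine sup_le (le_trans ?_ le_eventuallyMeasurableSpace) ?_
      · refine iSup₂_le fun j hj ↦ ?_
        have : Measurable[MeasurableSpace.comap (fun ω t ↦ Y t ω) (pastSigma (s n))] (Y j) :=
          @Measurable.comp _ _ _ (_) (pastSigma (s n)) _ _ _ (measurable_eval_pastSigma hj)
            (@comap_measurable _ _ (pastSigma (s n)) (fun ω t ↦ Y t ω))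
        exact measurable_iff_comap_le.1 this
      · refine MeasurableSpace.generateFrom_le fun N hN ↦ ?_
        exact ⟨∅, @MeasurableSet.empty _ (_), ae_eq_empty.2 hN⟩
    obtain ⟨_, ⟨B, hB, rfl⟩, hAB⟩ := h2 A h1
    exact ⟨B, hB, hAB⟩
  choose B hB hAB using hstep
  refine ⟨limsup B atTop, ?_, ?_⟩
  · have hle : ∀ r > t, MeasurableSet[pastSigma r] (limsup B atTop) := by
      intro r hr
      obtain ⟨N, hN⟩ := (hs_lim.eventually (gt_mem_nhds hr)).exists
      rw [← limsup_nat_add B N]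
      refine @MeasurableSet.measurableSet_limsup _ (pastSigma r) _ fun n ↦ ?_
      exact pastSigma_mono ((hs_anti.antitone (Nat.le_add_left N n)).trans hN.le) _ (hB (n + N))
    rw [germSigma, MeasurableSpace.measurableSet_iInf]
    intro r
    rw [MeasurableSpace.measurableSet_iInf]
    exact hle r
  · have hall : ∀ᵐ ω ∂P, ∀ n, (ω ∈ A ↔ (fun t ↦ Y t ω) ∈ B n) := ae_all_iff.2 fun n ↦
      (hAB n).mem_iff
    filter_upwards [hall] with ω hω
    refine propext ?_
    change ω ∈ A ↔ (fun t ↦ Y t ω) ∈ limsup B atTop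
    rw [mem_limsup_iff_frequently_mem]
    simp_rw [← hω]
    simp

/-! ### The Markov property and the zero-one law -/

/-- The transition function of the bridge: the ratio of the two densities that the law of the
bridge has on the germ `σ`-algebra at `t`, with and without the weight `f (ζ_s)`, as long as the
bridge has not reached `1`. -/
theorem IsStandardGammaProcess.exists_transition [P.IsComplete] (hγ : IsStandardGammaProcess γ P)
    (hτ : Measurable τ) (hτ_pos : ∀ ω, 0 < τ ω) (hindep : IndepFun τ (fun ω t ↦ γ t ω) P)
    (hζ : ∀ t, StronglyMeasurable (gammaBridge γ τ t)) {t s : ℝ≥0} (hts : t ≤ s)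
    {f : ℝ → ℝ≥0∞} (hf : Measurable f) {C : ℝ≥0∞} (hC : C ≠ ∞) (hfC : ∀ x, f x ≤ C) :
    ∃ q : ℝ → ℝ≥0∞, Measurable q ∧ ∀ A,
      MeasurableSet[usualAugmentation P (Filtration.natural (gammaBridge γ τ) hζ) t] A →
      ∫⁻ ω in A, f (gammaBridge γ τ s ω) ∂P = ∫⁻ ω in A, q (gammaBridge γ τ t ω) ∂P := by
  rcases hts.eq_or_lt with rfl | hts
  · exact ⟨f, hf, fun A _ ↦ rfl⟩
  have hζm : ∀ t, Measurable (gammaBridge γ τ t) := fun t ↦ (hζ t).measurable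
  have hZ : Measurable (fun ω t ↦ gammaBridge γ τ t ω) := measurable_pi_lambda _ hζm
  have hTm : MeasurableSet {ω | t < τ ω} := measurableSet_lt measurable_const hτ
  obtain ⟨k, hk, hkeq⟩ := hγ.exists_lintegral_gammaBridge hτ hindep hζm hts hf hC hfC
  obtain ⟨k', hk', hkeq'⟩ := hγ.exists_lintegral_gammaBridge hτ hindep hζm hts
    (measurable_const (a := (1 : ℝ≥0∞))) ENNReal.one_ne_top (fun _ ↦ le_rfl)
  -- A germ event on the value at `t` may be added to any germ event.
  have hinter : ∀ A, MeasurableSet[germSigma t] A → ∀ B : Set ℝ, MeasurableSet B →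
      MeasurableSet[germSigma t] (A ∩ (fun x ↦ x t) ⁻¹' B) := fun A hA B hB ↦
    @MeasurableSet.inter _ (germSigma t) _ _ hA (measurable_eval_germSigma t hB)
  have hmeas : ∀ A, MeasurableSet[germSigma t] A →
      (P.restrict ((fun ω t ↦ gammaBridge γ τ t ω) ⁻¹' A ∩ {ω | t < τ ω})).map
        (gammaBridge γ τ t) =
      ((P.restrict ((fun ω t ↦ γ t ω) ⁻¹' A)).map (γ t)).withDensity k' := by
    intro A hA
    ext B hB
    have := hkeq' _ (hinter A hA B hB)
    rw [setLIntegral_one] at this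
    rw [Measure.map_apply (hζm t) hB, Measure.restrict_apply (hζm t hB),
      withDensity_apply _ hB, setLIntegral_map hB hk' (hγ.measurable t),
      Measure.restrict_restrict (hγ.measurable t hB)]
    convert this using 2
    · ext ω
      simp only [Set.mem_inter_iff, Set.mem_preimage]
      tauto
    · congr 1
      ext ω
      simp only [Set.mem_inter_iff, Set.mem_preimage]
      tauto
  have hk'top : ∀ᵐ ω ∂P, k' (γ t ω) ≠ ∞ := by
    have h1 := hkeq' Set.univ (@MeasurableSet.univ _ (germSigma t))
    rw [Set.preimage_univ, Set.preimage_univ, Set.univ_inter, setLIntegral_one,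
      setLIntegral_univ] at h1
    filter_upwards [ae_lt_top (hk'.comp (hγ.measurable t)) (h1 ▸ measure_ne_top P _)] with ω hω
    exact hω.ne
  have hk0 : ∀ᵐ ω ∂P, k' (γ t ω) = 0 → k (γ t ω) = 0 := by
    have hBm : MeasurableSet {x | k' x = 0} := hk' (measurableSet_singleton 0)
    have hA := measurable_eval_germSigma t hBm
    have h1 := hkeq _ hA
    have h2 := hkeq' _ hA
    have h3 : ∫⁻ ω in (fun ω t ↦ γ t ω) ⁻¹' ((fun x ↦ x t) ⁻¹' {x | k' x = 0}), k' (γ t ω) ∂P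
        = 0 := by
      exact (setLIntegral_eq_zero_iff (hγ.measurable t hBm) (hk'.comp (hγ.measurable t))).2
        (Eventually.of_forall fun ω hω ↦ hω)
    rw [h3, setLIntegral_one] at h2
    rw [Measure.restrict_eq_zero.2 h2, lintegral_zero_measure] at h1
    exact (setLIntegral_eq_zero_iff (hγ.measurable t hBm) (hk.comp (hγ.measurable t))).1 h1.symm
  have hq0m : Measurable (fun x ↦ k x / k' x) := hk.div hk'
  refine ⟨fun x ↦ if x = 1 then f 1 else k x / k' x,
    Measurable.ite (measurableSet_singleton 1) measurable_const hq0m, fun A hA ↦ ?_⟩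
  obtain ⟨B, hB, hAB⟩ := exists_germSigma_ae_eq hζ hA
  have hAm : MeasurableSet A := (usualAugmentation P _).le t A hA
  rw [← lintegral_inter_add_sdiff _ A hTm, ← lintegral_inter_add_sdiff (fun ω ↦ ite _ _ _) A hTm]
  congr 1
  · have hABT : (A ∩ {ω | t < τ ω} : Set Ω) =ᵐ[P]
        ((fun ω t ↦ gammaBridge γ τ t ω) ⁻¹' B ∩ {ω | t < τ ω} : Set Ω) :=
      hAB.inter (ae_eq_refl _)
    rw [setLIntegral_congr hABT, setLIntegral_congr hABT, hkeq B hB]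
    have hne : ∀ᵐ ω ∂P.restrict ((fun ω t ↦ gammaBridge γ τ t ω) ⁻¹' B ∩ {ω | t < τ ω}),
        (if gammaBridge γ τ t ω = 1 then f 1 else
          k (gammaBridge γ τ t ω) / k' (gammaBridge γ τ t ω)) =
        k (gammaBridge γ τ t ω) / k' (gammaBridge γ τ t ω) := by
      rw [ae_restrict_iff' ((hZ (germSigma_le_pi t B hB)).inter hTm)]
      filter_upwards [hγ.strictMono, hγ.zero] with ω hmono h0 hω
      rw [if_neg (gammaBridge_ne_one h0 hmono hω.2)]
    rw [lintegral_congr_ae hne, ← lintegral_map hq0m (hζm t), hmeas B hB,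
      lintegral_withDensity_eq_lintegral_mul _ hk' hq0m, lintegral_map (hk'.mul hq0m)
        (hγ.measurable t)]
    refine lintegral_congr_ae (ae_restrict_of_ae ?_)
    filter_upwards [hk'top, hk0] with ω htop hzero
    rw [Pi.mul_apply]
    by_cases h : k' (γ t ω) = 0
    · rw [hzero h, h, zero_mul]
    · rw [ENNReal.mul_div_cancel h htop]
  · refine setLIntegral_congr_fun_ae (hAm.diff hTm) ?_
    filter_upwards [hγ.strictMono, hγ.zero] with ω hmono h0 hω
    have hle : τ ω ≤ t := not_lt.1 hω.2
    rw [gammaBridge_eq_one h0 hmono (hτ_pos ω) hle,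
      gammaBridge_eq_one h0 hmono (hτ_pos ω) (hle.trans hts.le), if_pos rfl]

/-- The conditional expectation given any `σ`-algebra between that of `Y` and `m'` is the same, if
the integrals over the events of `m'` are those of a function of `Y`. -/
theorem condExp_ae_eq_of_setLIntegral {Ω : Type*} {m m' mΩ : MeasurableSpace Ω} {P : Measure Ω}
    [IsProbabilityMeasure P] (hm' : m' ≤ mΩ) (hmm' : m ≤ m')
    {Y : Ω → ℝ} (hY : Measurable[m] Y) {g : Ω → ℝ} (hg : Measurable g) (hg0 : ∀ ω, 0 ≤ g ω)
    (hgi : Integrable g P) {q : ℝ → ℝ≥0∞} (hq : Measurable q)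
    (h : ∀ A, MeasurableSet[m'] A →
      ∫⁻ ω in A, ENNReal.ofReal (g ω) ∂P = ∫⁻ ω in A, q (Y ω) ∂P) :
    P[g | m] =ᵐ[P] fun ω ↦ (q (Y ω)).toReal := by
  have hm : m ≤ mΩ := hmm'.trans hm'
  have hYm : Measurable Y := hY.mono hm le_rfl
  have hqY : Measurable (fun ω ↦ q (Y ω)) := hq.comp hYm
  have hfin : ∫⁻ ω, q (Y ω) ∂P ≠ ∞ := by
    have := h Set.univ (@MeasurableSet.univ _ m')
    rw [setLIntegral_univ, setLIntegral_univ] at this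
    rw [← this]
    exact ((hasFiniteIntegral_iff_ofReal (Eventually.of_forall hg0)).1 hgi.2).ne
  have hint : Integrable (fun ω ↦ (q (Y ω)).toReal) P :=
    integrable_toReal_of_lintegral_ne_top hqY.aemeasurable hfin
  refine (ae_eq_condExp_of_forall_setIntegral_eq hm hgi (fun _ _ _ ↦ hint.integrableOn)
    (fun A hA _ ↦ ?_) ?_).symm
  · rw [integral_toReal hqY.aemeasurable (ae_restrict_of_ae (ae_lt_top hqY hfin)),
      ← h A (hmm' A hA), integral_eq_lintegral_of_nonneg_ae (Eventually.of_forall hg0)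
        hg.aestronglyMeasurable]
  · exact ((hq.comp hY).ennreal_toReal).stronglyMeasurable.aestronglyMeasurable

/-- The conditional expectations given the augmented filtration and given `ζ_t` are the same
function of `ζ_t`. -/
theorem IsStandardGammaProcess.isMarkovProcess_gammaBridge [P.IsComplete]
    (hγ : IsStandardGammaProcess γ P) (hτ : Measurable τ) (hτ_pos : ∀ ω, 0 < τ ω)
    (hindep : IndepFun τ (fun ω t ↦ γ t ω) P)
    (hζ : ∀ t, StronglyMeasurable (gammaBridge γ τ t)) :
    IsMarkovProcess P (usualAugmentation P (Filtration.natural (gammaBridge γ τ) hζ))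
      (gammaBridge γ τ) := by
  have hadapt : ∀ t,
      Measurable[usualAugmentation P (Filtration.natural (gammaBridge γ τ) hζ) t]
        (gammaBridge γ τ t) := by
    intro t
    have h1 : Measurable[Filtration.natural (gammaBridge γ τ) hζ t] (gammaBridge γ τ t) :=
      measurable_iff_comap_le.2 (le_iSup₂ (f := fun j (_ : j ≤ t) ↦
        MeasurableSpace.comap (gammaBridge γ τ j) (borel ℝ)) t le_rfl)
    exact h1.mono (le_sup_left.trans
      (Filtration.le_rightCont (completedFiltration P _) t)) le_rfl
  refine ⟨hadapt, fun t h f hf ⟨C, hC⟩ ↦ ?_⟩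
  have hζm : ∀ t, Measurable (gammaBridge γ τ t) := fun t ↦ (hζ t).measurable
  set F := usualAugmentation P (Filtration.natural (gammaBridge γ τ) hζ) with hF
  have hle : MeasurableSpace.comap (gammaBridge γ τ t) inferInstance ≤ F t :=
    measurable_iff_comap_le.1 (hadapt t)
  -- Adding a constant reduces the claim to a nonnegative function.
  set g : Ω → ℝ := fun ω ↦ f (gammaBridge γ τ (t + h) ω) + C with hg
  have hg0 : ∀ ω, 0 ≤ g ω := fun ω ↦ by
    linarith [neg_le_of_abs_le (hC (gammaBridge γ τ (t + h) ω))]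
  have hfm : Measurable (fun ω ↦ f (gammaBridge γ τ (t + h) ω)) := hf.comp (hζm _)
  have hfi : Integrable (fun ω ↦ f (gammaBridge γ τ (t + h) ω)) P :=
    Integrable.of_bound hfm.aestronglyMeasurable C (Eventually.of_forall fun ω ↦ hC _)
  have hgi : Integrable g P := hfi.add (integrable_const C)
  obtain ⟨q, hq, hqeq⟩ := hγ.exists_transition hτ hτ_pos hindep hζ (le_add_of_nonneg_right zero_le :
    t ≤ t + h) (f := fun x ↦ ENNReal.ofReal (f x + C)) (by fun_prop) (C := ENNReal.ofReal (C + C))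
    ENNReal.ofReal_ne_top
    (fun x ↦ ENNReal.ofReal_le_ofReal (by linarith [le_of_abs_le (hC x)]))
  have hgF : P[g | F t] =ᵐ[P] fun ω ↦ (q (gammaBridge γ τ t ω)).toReal :=
    condExp_ae_eq_of_setLIntegral (F.le t) le_rfl (hadapt t) (hfm.add_const C) hg0 hgi hq hqeq
  have hgY : P[g | MeasurableSpace.comap (gammaBridge γ τ t) inferInstance] =ᵐ[P]
      fun ω ↦ (q (gammaBridge γ τ t ω)).toReal :=
    condExp_ae_eq_of_setLIntegral (F.le t) hle (comap_measurable _) (hfm.add_const C) hg0 hgi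
      hq hqeq
  have hsub : ∀ m : MeasurableSpace Ω, m ≤ mΩ →
      P[fun ω ↦ f (gammaBridge γ τ (t + h) ω) | m] =ᵐ[P] fun ω ↦ P[g | m] ω - C := by
    intro m hm
    have h1 := condExp_sub (m := m) hgi (integrable_const C)
    rw [condExp_const hm] at h1
    have h2 : g - (fun _ ↦ C) = fun ω ↦ f (gammaBridge γ τ (t + h) ω) := by
      ext ω
      simp [hg]
    rwa [h2] at h1
  filter_upwards [hsub _ (F.le t), hsub _ (hle.trans (F.le t)), hgF, hgY] with ω h1 h2 h3 h4
  rw [h1, h2, h3, h4]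

/-- Blumenthal's zero-one law for the gamma process: as `γ_0 = 0`, a germ event at time `0` is
almost surely an event of the increments after `0`, and thus independent of itself. -/
theorem IsStandardGammaProcess.measure_germSigma_zero (hγ : IsStandardGammaProcess γ P)
    {B : Set (ℝ≥0 → ℝ)} (hB : MeasurableSet[germSigma 0] B) :
    P ((fun ω t ↦ γ t ω) ⁻¹' B) = 0 ∨ P ((fun ω t ↦ γ t ω) ⁻¹' B) = 1 := by
  have hind := indep_germSigma_futurePath hγ.measurable hγ.zero hγ.indep_increments hγ.cadlag 0
  have hB' := germSigma_le_pi 0 B hB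
  have h := (Indep_iff _ _ P).1 hind _ _ ⟨B, hB, rfl⟩ ⟨B, hB', rfl⟩
  have hae : (fun ω ↦ futurePath 0 (fun t ↦ γ t ω)) ⁻¹' B =ᵐ[P] (fun ω t ↦ γ t ω) ⁻¹' B := by
    have : (fun ω ↦ futurePath 0 (fun t ↦ γ t ω)) =ᵐ[P] fun ω t ↦ γ t ω := by
      filter_upwards [hγ.zero] with ω hω
      ext t
      simp [futurePath, hω]
    exact this.fun_comp (· ∈ B)
  rw [measure_congr hae, measure_congr ((ae_eq_refl _).inter hae), Set.inter_self] at h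
  rcases eq_or_ne (P ((fun ω t ↦ γ t ω) ⁻¹' B)) 0 with h0 | h0
  · exact Or.inl h0
  · refine Or.inr ((ENNReal.mul_right_inj h0 (measure_ne_top _ _)).1 ?_)
    rw [mul_one]
    exact h.symm

/-- At time `0` the density of the bridge with respect to the gamma process is constant on germ
events, so that these have the same probability for both processes. -/
theorem IsStandardGammaProcess.measure_gammaBridge_germSigma_zero
    (hγ : IsStandardGammaProcess γ P)
    (hτ : Measurable τ) (hτ_pos : ∀ ω, 0 < τ ω) (hindep : IndepFun τ (fun ω t ↦ γ t ω) P)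
    (hζ : ∀ t, Measurable (gammaBridge γ τ t)) {B : Set (ℝ≥0 → ℝ)}
    (hB : MeasurableSet[germSigma 0] B) :
    P ((fun ω t ↦ gammaBridge γ τ t ω) ⁻¹' B) = P ((fun ω t ↦ γ t ω) ⁻¹' B) := by
  obtain ⟨k, hk, hkeq⟩ := hγ.exists_lintegral_gammaBridge hτ hindep hζ zero_lt_one
    (measurable_const (a := (1 : ℝ≥0∞))) ENNReal.one_ne_top (fun _ ↦ le_rfl)
  have huniv : {ω | 0 < τ ω} = Set.univ := Set.eq_univ_of_forall hτ_pos
  have key : ∀ A, MeasurableSet[germSigma 0] A →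
      P ((fun ω t ↦ gammaBridge γ τ t ω) ⁻¹' A) = k 0 * P ((fun ω t ↦ γ t ω) ⁻¹' A) := by
    intro A hA
    have h := hkeq A hA
    rw [huniv, Set.inter_univ, setLIntegral_one] at h
    rw [h, ← setLIntegral_const]
    refine lintegral_congr_ae (ae_restrict_of_ae ?_)
    filter_upwards [hγ.zero] with ω hω
    rw [hω]
  have h1 := key Set.univ (@MeasurableSet.univ _ (germSigma 0))
  rw [Set.preimage_univ, Set.preimage_univ, measure_univ, mul_one] at h1
  rw [key B hB, ← h1, one_mul]

end GammaBridge

theorem mainTheorem1 {Ω : Type*} {mΩ : MeasurableSpace Ω} (P : Measure Ω)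
    [IsProbabilityMeasure P] [P.IsComplete]
    (γ : ℝ≥0 → Ω → ℝ) (hγ : IsStandardGammaProcess γ P)
    (τ : Ω → ℝ≥0) (hτ : Measurable τ) (hτ_pos : ∀ ω, 0 < τ ω)
    (hindep : IndepFun τ (fun ω t ↦ γ t ω) P)
    (hmoment : ∃ α : ℝ, 0 < α ∧ Integrable (fun ω ↦ (τ ω : ℝ) ^ α) P) :
    ∃ hζ : ∀ t, StronglyMeasurable (gammaBridge γ τ t),
      IsMarkovProcess P (usualAugmentation P (Filtration.natural (gammaBridge γ τ) hζ))
        (gammaBridge γ τ) ∧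
      ∀ A, MeasurableSet[(Filtration.natural (gammaBridge γ τ) hζ).rightCont 0] A →
        P A = 0 ∨ P A = 1 := by
  have hζm : ∀ t, Measurable (gammaBridge γ τ t) := measurable_gammaBridge hγ hτ
  have hζ : ∀ t, StronglyMeasurable (gammaBridge γ τ t) := fun t ↦ (hζm t).stronglyMeasurable
  refine ⟨hζ, hγ.isMarkovProcess_gammaBridge hτ hτ_pos hindep hζ, fun A hA ↦ ?_⟩
  have hA' : MeasurableSet[usualAugmentation P (Filtration.natural (gammaBridge γ τ) hζ) 0] A := by
    rw [usualAugmentation, Filtration.rightCont_eq]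
    rw [Filtration.rightCont_eq] at hA
    have hle : ⨅ s > (0 : ℝ≥0), (Filtration.natural (gammaBridge γ τ) hζ s : MeasurableSpace Ω) ≤
        ⨅ s > (0 : ℝ≥0), completedFiltration P (Filtration.natural (gammaBridge γ τ) hζ) s :=
      iInf₂_mono fun _ _ ↦ le_sup_left
    exact hle A hA
  obtain ⟨B, hB, hAB⟩ := exists_germSigma_ae_eq hζ hA'
  rw [measure_congr hAB, hγ.measure_gammaBridge_germSigma_zero hτ hτ_pos hindep hζm hB]
  exact hγ.measure_germSigma_zero hB
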